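/- Let $k$ be an algebraically closed field of characteristic $p>0$, and let $i\colon X\hookrightarrow\mathbb{P}^n_k$ be a closed immersion, where $X$ is a smooth (integral) projective variety over $k$. Put $\mathcal{O}_X(m)=i^*\mathcal{O}_{\mathbb{P}^n}(m)$ and $G(m)=G\otimes_{\mathcal{O}_X}\mathcal{O}_X(m)$ for every sheaf of $\mathcal{O}_X$-modules $G$ and every $m\in\mathbb{Z}$. Call a vector bundle (locally free sheaf of finite rank) $G$ on $X$ an \emph{ACM bundle} if $H^j(X,G(m))=0$ for all integers $j$ with $0<j<\dim X$ and all $m\in\mathbb{Z}$. Let $F\colon X\to X$ be the absolute Frobenius morphism, i.e. the identity on the underlying topological space and $a\mapsto a^p$ on sections of $\mathcal{O}_X$. If $E$ is an ACM bundle on $X$, then $F_*(E)$ is an ACM bundle on $X$ (in particular, $F_*(E)$ is locally free of finite rank). -/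

import Mathlib

universe u

open CategoryTheory AlgebraicGeometry TopologicalSpace Opposite

noncomputable section

namespace PushACM

/-! ### Serre's twisting sheaves on `Proj` -/

section Twist

variable {A σ : Type u} [CommRing A] [SetLike σ A] [AddSubgroupClass σ A]
  (𝒜 : ℕ → σ) [GradedRing 𝒜] (m : ℤ)

/-- The localization `A_𝔭` of the whole ring `A` at a homogeneous prime `𝔭`. -/
abbrev LocAt (x : ProjectiveSpectrum 𝒜) : Type u :=
  Localization x.asHomogeneousIdeal.toIdeal.primeCompl

/-- The fraction `r / s` in `A_𝔭`. -/
abbrev fracAt (x : ProjectiveSpectrum 𝒜) (r s : A)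
    (hs : s ∈ x.asHomogeneousIdeal.toIdeal.primeCompl) : LocAt 𝒜 x :=
  Localization.mk r ⟨s, hs⟩

lemma fracAt_add (x : ProjectiveSpectrum 𝒜) (a b c d : A) (hb hd) :
    fracAt 𝒜 x a b hb + fracAt 𝒜 x c d hd =
      fracAt 𝒜 x (b * c + d * a) (b * d) (mul_mem hb hd) :=
  Localization.add_mk _ _ _ _

lemma fracAt_mul (x : ProjectiveSpectrum 𝒜) (a b c d : A) (hb hd) :
    fracAt 𝒜 x a b hb * fracAt 𝒜 x c d hd = fracAt 𝒜 x (a * c) (b * d) (mul_mem hb hd) :=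
  Localization.mk_mul _ _ _ _

/-- `f` is given on `U` by one fraction `r / s` with `r`, `s` homogeneous and
`deg r - deg s = m`. -/
def IsTwistedFraction {U : Opens (ProjectiveSpectrum.top 𝒜)} (f : ∀ x : U, LocAt 𝒜 x.1) :
    Prop :=
  ∃ (d e : ℕ) (r : 𝒜 d) (s : 𝒜 e), (d : ℤ) = e + m ∧
    ∀ x : U, ∃ hs, f x = fracAt 𝒜 x.1 r.1 s.1 hs

/-- Being a fraction of degree `m` is stable under restriction to smaller opens. -/
def isTwistedFractionPrelocal :
    TopCat.PrelocalPredicate (fun x : ProjectiveSpectrum.top 𝒜 => LocAt 𝒜 x) where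
  pred f := IsTwistedFraction 𝒜 m f
  res := by
    rintro V U i f ⟨d, e, r, s, h, w⟩
    exact ⟨d, e, r, s, h, fun x => w (i x)⟩

/-- Being locally a fraction of degree `m`. -/
def isLocallyTwistedFraction :
    TopCat.LocalPredicate (fun x : ProjectiveSpectrum.top 𝒜 => LocAt 𝒜 x) :=
  (isTwistedFractionPrelocal 𝒜 m).sheafify

lemma exists_homogeneous_notMem (x : ProjectiveSpectrum 𝒜) :
    ∃ (e : ℕ) (s : 𝒜 e), 0 ≤ e + m ∧ s.1 ∈ x.asHomogeneousIdeal.toIdeal.primeCompl := by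
  classical
  obtain ⟨f, d, hf, hd, hx⟩ : ∃ (f : A) (d : ℕ) (_ : f ∈ 𝒜 d) (_ : 0 < d),
      f ∉ x.asHomogeneousIdeal.toIdeal := by
    by_contra! H
    refine x.not_irrelevant_le fun z hz => ?_
    rw [← DirectSum.sum_support_decompose 𝒜 z]
    refine x.1.toIdeal.sum_mem fun k hk => H _ k (SetLike.coe_mem _) ?_
    by_contra h0
    obtain rfl : k = 0 := by omega
    have h1 := (HomogeneousIdeal.mem_irrelevant_iff _ _).mp hz
    rw [GradedRing.proj_apply] at h1
    simp at hk
    exact hk (Subtype.ext h1)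
  refine ⟨m.natAbs • d, ⟨f ^ m.natAbs, SetLike.pow_mem_graded _ hf⟩, ?_,
    Submonoid.pow_mem _ hx _⟩
  have : m.natAbs ≤ m.natAbs * d := Nat.le_mul_of_pos_right _ hd
  simp only [smul_eq_mul]
  omega

/-- The sections of `𝒪(m)` over `U`: functions `f` on `U` with `f(𝔭) ∈ A_𝔭` which are locally
fractions of degree `m`. -/
def twistSections (U : (Opens (ProjectiveSpectrum.top 𝒜))ᵒᵖ) :
    AddSubgroup (∀ x : U.unop, LocAt 𝒜 x.1) where
  carrier := {f | (isLocallyTwistedFraction 𝒜 m).pred f}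
  zero_mem' x := by
    obtain ⟨e, s, he, hs⟩ := exists_homogeneous_notMem 𝒜 m x.1
    refine ⟨U.unop ⊓ ProjectiveSpectrum.basicOpen 𝒜 s.1, ⟨x.2, hs⟩, Opens.infLELeft _ _,
      (e + m).toNat, e, ⟨0, zero_mem _⟩, s, by omega, fun y => ⟨y.2.2, ?_⟩⟩
    exact (Localization.mk_zero _).symm
  add_mem' {a b} ha hb x := by
    obtain ⟨Va, ma, ia, da, ea, ⟨ra, hra⟩, ⟨sa, hsa⟩, ha, wa⟩ := ha x
    obtain ⟨Vb, mb, ib, db, eb, ⟨rb, hrb⟩, ⟨sb, hsb⟩, hb, wb⟩ := hb x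
    have h : eb + da = ea + db := by omega
    refine ⟨Va ⊓ Vb, ⟨ma, mb⟩, Opens.infLELeft _ _ ≫ ia, ea + db, ea + eb,
      ⟨sa * rb + sb * ra, add_mem (SetLike.mul_mem_graded hsa hrb)
        (h ▸ SetLike.mul_mem_graded hsb hra)⟩,
      ⟨sa * sb, SetLike.mul_mem_graded hsa hsb⟩, by push_cast; omega, fun y => ?_⟩
    obtain ⟨ha', wa⟩ := wa ⟨y.1, y.2.1⟩
    obtain ⟨hb', wb⟩ := wb ⟨y.1, y.2.2⟩
    exact ⟨mul_mem ha' hb', (congrArg₂ (· + ·) wa wb).trans (fracAt_add 𝒜 y.1 _ _ _ _ _ _)⟩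
  neg_mem' {a} ha x := by
    obtain ⟨Va, ma, ia, da, ea, ⟨ra, hra⟩, ⟨sa, hsa⟩, ha, wa⟩ := ha x
    refine ⟨Va, ma, ia, da, ea, ⟨-ra, neg_mem hra⟩, ⟨sa, hsa⟩, ha, fun y => ?_⟩
    obtain ⟨h, e⟩ := wa y
    exact ⟨h, (congrArg Neg.neg e).trans (Localization.neg_mk _ _)⟩

/-- `𝒪(m)` as a sheaf of sets. -/
def twistInType : TopCat.Sheaf (Type u) (ProjectiveSpectrum.top 𝒜) :=
  TopCat.subsheafToTypes (isLocallyTwistedFraction 𝒜 m)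

/-- `𝒪(m)` as a presheaf of abelian groups. -/
def twistPresheaf : (Opens (Proj 𝒜))ᵒᵖ ⥤ Ab.{u} where
  obj U := AddCommGrpCat.of (twistSections 𝒜 m U)
  map i := AddCommGrpCat.ofHom
    { toFun := (twistInType 𝒜 m).1.map i
      map_zero' := rfl
      map_add' := fun _ _ => rfl }

/-- A section `g` of the structure sheaf acts on `𝒪(m)` by `(g • f)(𝔭) = g(𝔭) f(𝔭)` in `A_𝔭`. -/
def twistSmul (U : (Opens (ProjectiveSpectrum.top 𝒜))ᵒᵖ)
    (g : (ProjectiveSpectrum.Proj.structureSheaf 𝒜).1.obj U) (f : twistSections 𝒜 m U) :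
    twistSections 𝒜 m U :=
  ⟨fun x => (g.1 x).val * f.1 x, fun x => by
    obtain ⟨Va, ma, ia, d, ⟨ra, hra⟩, ⟨sa, hsa⟩, ha, wa⟩ := g.2 x
    obtain ⟨Vb, mb, ib, db, eb, ⟨rb, hrb⟩, ⟨sb, hsb⟩, hb, wb⟩ := f.2 x
    refine ⟨Va ⊓ Vb, ⟨ma, mb⟩, Opens.infLELeft _ _ ≫ ia, d + db, d + eb,
      ⟨ra * rb, SetLike.mul_mem_graded hra hrb⟩, ⟨sa * sb, SetLike.mul_mem_graded hsa hsb⟩,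
      by push_cast; omega, fun y => ?_⟩
    have wa := wa ⟨y.1, y.2.1⟩
    obtain ⟨hb', wb⟩ := wb ⟨y.1, y.2.2⟩
    refine ⟨mul_mem (ha ⟨y.1, y.2.1⟩) hb', ?_⟩
    exact (congrArg₂ (· * ·) ((congrArg HomogeneousLocalization.val wa).trans
      (HomogeneousLocalization.val_mk _)) wb).trans (fracAt_mul 𝒜 y.1 _ _ _ _ _ _)⟩

instance twistModule (U : (Opens (Proj 𝒜))ᵒᵖ) :
    Module ((Proj 𝒜).ringCatSheaf.obj.obj U) ((twistPresheaf 𝒜 m).obj U) where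
  smul g f := twistSmul 𝒜 m U g f
  one_smul f := Subtype.ext <| funext fun x =>
    (congrArg (· * f.1 x) HomogeneousLocalization.val_one).trans (one_mul _)
  mul_smul _ _ f := Subtype.ext <| funext fun x =>
    (congrArg (· * f.1 x) (HomogeneousLocalization.val_mul _ _)).trans (mul_assoc _ _ _)
  smul_zero _ := Subtype.ext <| funext fun _ => mul_zero _
  smul_add _ _ _ := Subtype.ext <| funext fun _ => mul_add _ _ _
  add_smul _ _ f := Subtype.ext <| funext fun x =>
    (congrArg (· * f.1 x) (HomogeneousLocalization.val_add _ _)).trans (add_mul _ _ _)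
  zero_smul f := Subtype.ext <| funext fun x =>
    (congrArg (· * f.1 x) HomogeneousLocalization.val_zero).trans (zero_mul _)

/-- Serre's twisting sheaf `𝒪(m)` on `Proj 𝒜`, as a sheaf of modules. -/
def twist : (Proj 𝒜).Modules where
  val := PresheafOfModules.ofPresheaf (R := (Proj 𝒜).ringCatSheaf.obj) (twistPresheaf 𝒜 m)
    (fun _ _ _ _ _ => rfl)
  isSheaf := (TopCat.Presheaf.isSheaf_iff_isSheaf_comp (forget AddCommGrpCat) _).2
    (twistInType 𝒜 m).2

end Twist

/-! ### Projective space -/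

section ProjectiveSpace

attribute [local instance] MvPolynomial.gradedAlgebra

/-- The grading of `k[x₀, …, xₙ]` by degree. -/
abbrev polyGrading (n : ℕ) (k : Type u) [Field k] :
    ℕ → Submodule k (MvPolynomial (Fin (n + 1)) k) :=
  MvPolynomial.homogeneousSubmodule (Fin (n + 1)) k

/-- Projective `n`-space `ℙⁿ` over `k`. -/
def projectiveSpace (n : ℕ) (k : Type u) [Field k] : Scheme.{u} :=
  Proj (polyGrading n k)

/-- The structure morphism `ℙⁿ ⟶ Spec k`. -/
def projectiveSpaceToSpec (n : ℕ) (k : Type u) [Field k] :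
    projectiveSpace n k ⟶ Spec (.of k) :=
  Proj.toSpecZero (polyGrading n k) ≫
    Spec.map (CommRingCat.ofHom (algebraMap k (polyGrading n k 0)))

/-- The sheaf `𝒪(m)` on `ℙⁿ`. -/
def serreTwist (n : ℕ) (k : Type u) [Field k] (m : ℤ) : (projectiveSpace n k).Modules :=
  twist (polyGrading n k) m

end ProjectiveSpace

/-! ### Sheaves of modules -/

section Modules

variable {X : Scheme.{u}}

/-- The tensor product of two sheaves of `𝒪_X`-modules: the sheafification of
`U ↦ E(U) ⊗ G(U)`. -/
def tensor (E G : X.Modules) : X.Modules :=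
  (PresheafOfModules.sheafification (𝟙 X.ringCatSheaf.obj)).obj
    (PresheafOfModules.Monoidal.tensorObj (R := X.presheaf) E.val G.val)

/-- A vector bundle: a sheaf of modules that is locally free of finite rank. -/
def IsVectorBundle (E : X.Modules) : Prop :=
  ∀ x : X, ∃ (U : X.Opens) (_ : x ∈ U) (r : ℕ),
    Nonempty (E.restrict U.ι ≅
      (SheafOfModules.free (R := (U : Scheme.{u}).ringCatSheaf) (ULift.{u} (Fin r)) :
        (U : Scheme.{u}).Modules))

/-- The sheaf cohomology group `Hʲ(X, E)`. -/
abbrev cohomology (E : X.Modules) (j : ℕ) : Type u :=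
  Sheaf.H ((SheafOfModules.toSheaf X.ringCatSheaf).obj E) j

/-- For a morphism `i : X ⟶ ℙⁿ`, the twist `E(m) = E ⊗ 𝒪_X(m)` with `𝒪_X(m) = i^* 𝒪(m)`. -/
def twistBy {n : ℕ} {k : Type u} [Field k] (i : X ⟶ projectiveSpace n k) (E : X.Modules)
    (m : ℤ) : X.Modules :=
  tensor E ((Scheme.Modules.pullback i).obj (serreTwist n k m))

/-- `E` is an ACM bundle on `X` with respect to the embedding `i : X ⟶ ℙⁿ`. -/
def IsACM {n : ℕ} {k : Type u} [Field k] (i : X ⟶ projectiveSpace n k) (E : X.Modules) :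
    Prop :=
  IsVectorBundle E ∧
    ∀ (m : ℤ) (j : ℕ), 0 < j → (j : WithBot ℕ∞) < topologicalKrullDim X →
      Subsingleton (cohomology (twistBy i E m) j)

end Modules

/-! ### The absolute Frobenius -/

section Frobenius

/-- The `p`-th power map of a commutative ring in which `p = 0`. -/
def powRingHom {R : Type u} [CommRing R] (p : ℕ) [hp : Fact p.Prime] (h : (p : R) = 0) :
    R →+* R where
  toFun a := a ^ p
  map_one' := one_pow p
  map_mul' a b := mul_pow a b p
  map_zero' := zero_pow hp.out.ne_zero
  map_add' a b := by
    obtain ⟨r, hr⟩ := exists_add_pow_prime_eq hp.out a b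
    simp [hr, h]

lemma natCast_sections_eq_zero {X : Scheme.{u}} {p : ℕ} (h : (p : Γ(X, ⊤)) = 0) (U : X.Opens) :
    (p : Γ(X, U)) = 0 := by
  rw [← map_natCast (X.presheaf.map (homOfLE (le_top : U ≤ ⊤)).op).hom p, h, map_zero]

/-- The absolute Frobenius as a morphism of ringed spaces. -/
def frobeniusPresheafedSpace (X : Scheme.{u}) (p : ℕ) [Fact p.Prime] (h : (p : Γ(X, ⊤)) = 0) :
    X.toPresheafedSpace ⟶ X.toPresheafedSpace where
  base := 𝟙 _
  c :=
    { app := fun U => CommRingCat.ofHom (powRingHom p (natCast_sections_eq_zero h U.unop))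
      naturality := fun U V i => by
        ext a
        exact (map_pow (X.presheaf.map i).hom a p).symm }

/-- The absolute Frobenius `F : X ⟶ X` of a scheme with `p = 0` in `𝒪_X`: the identity on the
underlying space and `a ↦ a ^ p` on sections. -/
def absFrobenius (X : Scheme.{u}) (p : ℕ) [hp : Fact p.Prime] (h : (p : Γ(X, ⊤)) = 0) :
    X ⟶ X where
  toHom := frobeniusPresheafedSpace X p h
  prop x := by
    refine ⟨fun a ha => ?_⟩
    obtain ⟨U, hx, s, rfl⟩ := X.presheaf.exists_germ_eq a
    have h1 := PresheafedSpace.stalkMap_germ_apply (frobeniusPresheafedSpace X p h) U x hx s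
    have h2 := h1 ▸ ha
    have h3 := map_pow (X.presheaf.germ U x hx).hom s p
    exact (isUnit_pow_iff hp.out.ne_zero).mp (h3 ▸ h2)

lemma natCast_eq_zero_of_charP {X : Scheme.{u}} {k : Type u} [Field k] (p : ℕ) [CharP k p]
    (f : X ⟶ Spec (.of k)) : (p : Γ(X, ⊤)) = 0 := by
  have h := map_natCast (((Scheme.ΓSpecIso (.of k)).inv ≫ f.appTop).hom) p
  rw [← h]
  exact (congrArg _ (CharP.cast_eq_zero k p)).trans (map_zero _)

end Frobenius

end PushACM

end

noncomputable section

namespace PushACM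

/-! ### Flatness of the Frobenius of smooth algebras -/

section FrobeniusFlat

/-! Two facts carry the proof: the Frobenius `F` is finite and flat, and twisting `F_* E` by `m`
amounts to twisting `E` by `p m`.

Local freeness. Locally `X` is étale over an affine space. The Frobenius of a polynomial ring over
`k` is flat, and flatness passes to étale algebras (`flat_of_etale_of_etale`). It is finite because
`k` is perfect and the algebras are of finite type. A finite flat algebra over a Noetherian ring is
locally free (`exists_isBasisAlong_localization`), so locally `𝒪_X` has a basis `b_j` over its
`p`-th powers. If `s_i` is a local basis of `E`, the products `b_j s_i` form a local basis of `F_*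
E`.

Cohomology. By the projection formula `(F_* E)(m) ≅ F_*(E ⊗ F^* 𝒪_X(m)) ≅ F_*(E(p m))`, and since
`F` is the identity on points, this is `E(p m)` as a sheaf of abelian groups. The isomorphism is
written directly as `e ⊗ s ↦ e ⊗ s ^ p`. It is bijective on opens where `𝒪_X(m)` has a generator
whose `p`-th power generates `𝒪_X(p m)` (`bijective_tensorPow`), hence an isomorphism after
sheafification. Such generators are the pull-backs of `X_j ^ m` (`isGenerator_twistGen`,
`IsGenerator.pullback`). The vanishing for `E` at the twist `p m` then gives the vanishing for `F_*
E` at `m`. -/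

/-- The family `b` of elements of `S` is a basis of `S` as an `R`-module via `φ`. -/
def IsBasisAlong {R S ι : Type*} [CommRing R] [CommRing S] [Fintype ι] (φ : R →+* S)
    (b : ι → S) : Prop :=
  Function.Bijective fun c : ι → R => ∑ i, φ (c i) * b i

lemma IsBasisAlong.flat {R S ι : Type*} [CommRing R] [CommRing S] [Fintype ι] {φ : R →+* S}
    {b : ι → S} (hb : IsBasisAlong φ b) : φ.Flat := by
  algebraize [φ]
  have : Function.Bijective (Fintype.linearCombination R b) := by
    convert! hb using 1
  exact .of_linearEquiv (LinearEquiv.ofBijective _ this).symm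

-- Every exponent is uniquely `n * p + j` with `j < p`, and the coefficient of the sum there is the
-- `n`-th coefficient of `c j`.
open Polynomial in
lemma isBasisAlong_expand {R : Type*} [CommRing R] {p : ℕ} (hp : p ≠ 0) :
    IsBasisAlong (expand R p : R[X] →+* R[X]) (fun i : Fin p => (X : R[X]) ^ (i : ℕ)) := by
  have hp' : 0 < p := Nat.pos_of_ne_zero hp
  have key (c : Fin p → R[X]) (n : ℕ) (j : Fin p) :
      (∑ i, (expand R p : R[X] →+* R[X]) (c i) * X ^ (i : ℕ)).coeff (n * p + j) =
        (c j).coeff n := by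
    rw [finsetSum_coeff, Finset.sum_eq_single j]
    · simp [coeff_mul_X_pow, coeff_expand_mul hp']
    · intro i _ hij
      simp only [RingHom.coe_coe, coeff_mul_X_pow']
      split_ifs with h
      · rw [coeff_expand hp', if_neg]
        rintro ⟨d, hd⟩
        have h1 : n * p + j = p * d + i := by omega
        have h2 := congrArg (· % p) h1
        simp [Nat.add_mod, Nat.mod_eq_of_lt] at h2
        exact hij (Fin.ext h2.symm)
      · rfl
    · simp
  -- `divX^[i]` shifts the coefficients by `i`, and `contract p` then keeps every `p`-th one.
  refine ⟨fun c d h => ?_, fun f => ⟨fun i => contract p (divX^[i] f), ?_⟩⟩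
  · ext j n
    rw [← key c, ← key d]
    exact congrArg (coeff · _) h
  · have hdiv (i n : ℕ) : (divX^[i] f).coeff n = f.coeff (n + i) := by
      induction i generalizing n with
      | zero => rfl
      | succ i ih => rw [Function.iterate_succ_apply', coeff_divX, ih]; congr 1; omega
    ext n
    have hn : n = n / p * p + (⟨n % p, Nat.mod_lt _ hp'⟩ : Fin p) := (Nat.div_add_mod' n p).symm
    rw [hn, key, coeff_contract hp, hdiv]

/-- `ψ` factors as `A → R' ⊗[R] A → A'`. The first map is a base change of `φ`; the second is a map
between étale `R'`-algebras, hence étale and flat. -/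
lemma flat_of_etale_of_etale {R R' A A' : Type u} [CommRing R] [CommRing R'] [CommRing A]
    [CommRing A'] (φ : R →+* R') (f : R →+* A) (f' : R' →+* A') (ψ : A →+* A')
    (h : ψ.comp f = f'.comp φ) (hφ : φ.Flat) (hf : f.Etale) (hf' : f'.Etale) : ψ.Flat := by
  algebraize [φ, f, f', ψ, ψ.comp f]
  have : IsScalarTower R R' A' := .of_algebraMap_eq' h
  let g : TensorProduct R R' A →ₐ[R'] A' :=
    Algebra.TensorProduct.lift (Algebra.ofId R' A') (IsScalarTower.toAlgHom R A A')
      (fun _ _ => Commute.all _ _)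
  have hg : g.toRingHom.Flat := by
    algebraize [g.toRingHom]
    have : IsScalarTower R' (TensorProduct R R' A) A' := .of_algebraMap_eq' g.comp_algebraMap.symm
    have : Algebra.Etale (TensorProduct R R' A) A' := .of_restrictScalars R' _ _
    exact Algebra.Smooth.flat _ _
  have hi : (Algebra.TensorProduct.includeRight : A →ₐ[R] TensorProduct R R' A).toRingHom.Flat := by
    let _ := (Algebra.TensorProduct.includeRight : A →ₐ[R] TensorProduct R R' A).toRingHom.toAlgebra
    have e : TensorProduct R A R' ≃ₗ[A] TensorProduct R R' A :=
      { __ := TensorProduct.comm R A R'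
        map_smul' := fun a x => by
          induction x with
          | zero => simp
          | add x y hx hy => simp_all [smul_add]
          | tmul x y => simp [Algebra.smul_def,
              RingHom.algebraMap_toAlgebra] }
    exact .of_linearEquiv e.symm
  convert hi.comp hg
  ext a
  simp [g, RingHom.algebraMap_toAlgebra]

-- The Frobenius of `R[X]` is the Frobenius on coefficients, a base change of that of `R`, followed
-- by `X ↦ X ^ p`.
attribute [local instance] Polynomial.algebra in
lemma powRingHom_polynomial_flat {R : Type u} [CommRing R] {p : ℕ} [hp : Fact p.Prime]
    (h : (p : R) = 0) (hR : (powRingHom p h).Flat) (h' : (p : Polynomial R) = 0) :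
    (powRingHom p h').Flat := by
  have hm : (Polynomial.mapRingHom (powRingHom p h)).Flat := by
    have key {R S : Type u} [CommRing R] [CommRing S] (φ : R →+* S) (hφ : φ.Flat) :
        (Polynomial.mapRingHom φ).Flat := by
      algebraize [φ]
      rw [show Polynomial.mapRingHom φ = algebraMap (Polynomial R) (Polynomial S) from rfl,
        RingHom.flat_algebraMap_iff]
      exact Module.Flat.isBaseChange R (Polynomial R) S (Polynomial S)
        (Algebra.IsPushout.out (R := R) (S := Polynomial R) (R' := S) (S' := Polynomial S))
    exact key _ hR
  convert hm.comp (isBasisAlong_expand hp.out.ne_zero).flat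
  ext <;> simp [powRingHom, ← map_pow]

lemma natCast_eq_zero_of_ringHom {R S : Type*} [CommRing R] [CommRing S] (f : R →+* S) {p : ℕ}
    (h : (p : R) = 0) : (p : S) = 0 := by
  rw [← map_natCast f, h, map_zero]

lemma flat_powRingHom_of_ringEquiv {R S : Type u} [CommRing R] [CommRing S] (e : R ≃+* S) {p : ℕ}
    [Fact p.Prime] (h : (p : R) = 0) (hR : (powRingHom p h).Flat) (h' : (p : S) = 0) :
    (powRingHom p h').Flat := by
  convert (RingHom.Flat.of_bijective (f := (e.symm : S →+* R)) e.symm.bijective).comp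
    (hR.comp (RingHom.Flat.of_bijective (f := (e : R →+* S)) e.bijective))
  ext x
  simp [powRingHom]

lemma flat_powRingHom_mvPolynomial {k : Type u} [Field k] (p : ℕ) [Fact p.Prime]
    (h : (p : k) = 0) (n : ℕ) (h' : (p : MvPolynomial (Fin n) k) = 0) :
    (powRingHom p h').Flat := by
  induction n with
  | zero =>
    exact flat_powRingHom_of_ringEquiv (MvPolynomial.isEmptyAlgEquiv k (Fin 0)).symm.toRingEquiv h
      (RingHom.Flat.of_isField (Field.toIsField k) _) _
  | succ n ih =>
    have h1 := natCast_eq_zero_of_ringHom (MvPolynomial.C (σ := Fin n)) h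
    exact flat_powRingHom_of_ringEquiv (MvPolynomial.finSuccEquiv k n).symm.toRingEquiv
      (natCast_eq_zero_of_ringHom Polynomial.C h1) (powRingHom_polynomial_flat h1 (ih h1) _) _

lemma flat_powRingHom_of_isStandardSmooth {k A : Type u} [Field k] [CommRing A] {f : k →+* A}
    (hf : f.IsStandardSmooth) (p : ℕ) [Fact p.Prime] (hk : (p : k) = 0) (h : (p : A) = 0) :
    (powRingHom p h).Flat := by
  obtain ⟨n, g, -, hg⟩ := hf.exists_etale_mvPolynomial
  refine flat_of_etale_of_etale _ g g _ ?_ (flat_powRingHom_mvPolynomial p hk n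
    (natCast_eq_zero_of_ringHom MvPolynomial.C hk)) hg hg
  exact RingHom.ext fun x => (map_pow g x p).symm

/-- An algebra that is integral and of finite type is finite. Each `x` is a root of `T ^ p - x`,
whose constant term acts through the Frobenius as `x ^ p`. Finite type follows from that of `f`
because the Frobenius of `k` is surjective. -/
lemma finite_powRingHom_of_finiteType {k A : Type u} [Field k] [CommRing A] {f : k →+* A}
    (hf : f.FiniteType) (p : ℕ) [hp : Fact p.Prime] (hk : Function.Surjective fun x : k => x ^ p)
    (hk' : (p : k) = 0) (h : (p : A) = 0) : (powRingHom p h).Finite := by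
  refine RingHom.IsIntegral.to_finite (fun x => ?_) (.of_comp_finiteType (f := f) ?_)
  · refine ⟨Polynomial.X ^ p - Polynomial.C x, Polynomial.monic_X_pow_sub_C x hp.out.ne_zero, ?_⟩
    rw [Polynomial.eval₂_sub, Polynomial.eval₂_X_pow, Polynomial.eval₂_C]
    exact sub_self _
  · have : (powRingHom p h).comp f = f.comp (powRingHom p hk') :=
      RingHom.ext fun x => (map_pow f x p).symm
    rw [this]
    exact hf.comp (.of_surjective _ hk)

/-- Over the local ring at `q` the finite flat module `B` is free, and by finite presentation a
basis spreads out to a neighbourhood of `q`. Arbitrary models `A'`, `B'` of the localizations are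
allowed so that rings of sections can be substituted. -/
lemma exists_isBasisAlong_localization {A B : Type u} [CommRing A] [CommRing B]
    [IsNoetherianRing A] {φ : A →+* B} (hf : φ.Finite) (hφ : φ.Flat) (q : Ideal A) [q.IsPrime] :
    ∃ f ∉ q, ∃ (N : ℕ) (b : Fin N → B), ∀ g, f ∣ g → ∀ (A' B' : Type u) [CommRing A'] [CommRing B']
      [Algebra A A'] [Algebra B B'] [IsLocalization.Away g A'] [IsLocalization.Away (φ g) B']
      (φ' : A' →+* B'), φ'.comp (algebraMap A A') = (algebraMap B B').comp φ →
      IsBasisAlong φ' (fun i => algebraMap B B' (b i)) := by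
  algebraize [φ]
  have : Module.FinitePresentation A B := Module.finitePresentation_of_finite A B
  let Aq := Localization.AtPrime q
  have : Module.Free Aq (LocalizedModule.AtPrime q B) := Module.free_of_flat_of_isLocalRing
  let e := Module.finBasis Aq (LocalizedModule.AtPrime q B)
  set N := Module.finrank Aq (LocalizedModule.AtPrime q B)
  let u : (Fin N → A) →ₗ[A] Fin N → Aq := 
    LinearMap.pi fun i => Algebra.linearMap A Aq ∘ₗ LinearMap.proj i
  let v := LocalizedModule.mkLinearMap q.primeCompl B
  let w := (e.equivFun.restrictScalars A).symm
  -- The basis of the localized module lifts to `B` only after multiplication by a denominator `s`,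
  -- which is harmless because `s` is invertible at `q`.
  obtain ⟨l, s, hl⟩ := Module.FinitePresentation.exists_lift_of_isLocalizedModule q.primeCompl v
    (w.toLinearMap ∘ₗ u)
  have hbij : Function.Bijective (IsLocalizedModule.map q.primeCompl u v l) := by
    have : IsLocalizedModule.map q.primeCompl u v l = (s • LinearMap.id) ∘ₗ w.toLinearMap := by
      apply IsLocalizedModule.ext q.primeCompl u (IsLocalizedModule.map_units v)
      rw [IsLocalizedModule.map_comp, hl]
      rfl
    rw [this]
    exact ((Module.End.isUnit_iff _).mp (IsLocalizedModule.map_units v s)).comp w.bijective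
  obtain ⟨f, hfq, hf⟩ := exists_bijective_map_powers q.primeCompl u v l hbij
  refine ⟨f, hfq, N, fun i => l (Pi.single i 1), fun g hg A' B' _ _ _ _ _ _ φ' h => ?_⟩
  specialize hf g hg
  algebraize [φ', (algebraMap B B').comp φ]
  have : IsScalarTower A A' B' := .of_algebraMap_eq' h.symm
  let u' : (Fin N → A) →ₗ[A] Fin N → A' := 
    LinearMap.pi fun i => Algebra.linearMap A A' ∘ₗ LinearMap.proj i
  let v' := (IsScalarTower.toAlgHom A B B').toLinearMap
  -- Localizing `B` at `g` as an `A`-module is localizing the ring `B` at `φ g`.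
  have : IsLocalizedModule (.powers g) v' := by
    rw [isLocalizedModule_iff_isLocalization]
    simp only [Algebra.algebraMapSubmonoid, Submonoid.map_powers]
    exact ‹IsLocalization.Away (φ g) B'›
  rw [← IsLocalizedModule.map_bijective_iff_localizedModuleMap_bijective u' v'] at hf
  have : IsLocalizedModule.map (.powers g) u' v' l =
      (Fintype.linearCombination A' fun i => v' (l (Pi.single i 1))).restrictScalars A := by
    apply IsLocalizedModule.ext (.powers g) u' (IsLocalizedModule.map_units v')
    rw [IsLocalizedModule.map_comp]
    ext i
    simp [u', Fintype.linearCombination_apply, Pi.single_apply]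
  rw [this] at hf
  exact hf

end FrobeniusFlat

/-! ### Local bases of the structure sheaf over the Frobenius -/

section FrobeniusBasis

variable {X : Scheme.{u}}

lemma mem_basicOpen_iff_notMem_comap_germ {V : X.Opens} {x : X} (hx : x ∈ V) (f : Γ(X, V)) :
    x ∈ X.basicOpen f ↔
      f ∉ (IsLocalRing.maximalIdeal (X.presheaf.stalk x)).comap (X.presheaf.germ V x hx).hom := by
  rw [Scheme.mem_basicOpen X f x hx]
  simp

/-- An affine open neighbourhood of a point of a smooth scheme over an algebraically closed field
on which the structure sheaf has a basis over its `p`-th powers. -/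
lemma exists_isBasisAlong_powRingHom {k : Type u} [Field k] [IsAlgClosed k] (p : ℕ)
    [hp : Fact p.Prime] [CharP k p] (f : X ⟶ Spec (.of k)) [Smooth f] (h : (p : Γ(X, ⊤)) = 0)
    (x : X) (U₀ : X.Opens) (hx : x ∈ U₀) :
    ∃ (U : X.Opens) (_ : U ≤ U₀) (_ : x ∈ U) (N : ℕ) (b : Fin N → Γ(X, U)),
      ∀ V ≤ U, ∀ y ∈ V, ∃ (W : X.Opens) (_ : W ≤ V) (_ : y ∈ W) (hW : W ≤ U),
        IsBasisAlong (powRingHom p (natCast_sections_eq_zero h W))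
          (fun i => (X.presheaf.map (homOfLE hW).op).hom (b i)) := by
  obtain ⟨W, hW, V, hV, hxV, e, hstd⟩ := Smooth.exists_isStandardSmooth f x
  -- `Spec k` has only one point.
  obtain rfl : W = ⊤ := by
    ext y
    have : y = f x := Subsingleton.elim (α := PrimeSpectrum k) _ _
    simpa [this] using e hxV
  let φ : k →+* Γ(X, V) := ((Scheme.ΓSpecIso (.of k)).inv ≫ f.appLE ⊤ V e).hom
  have hφ : φ.IsStandardSmooth :=
    RingHom.isStandardSmooth_respectsIso.2 (f.appLE ⊤ V e).hom
      (Scheme.ΓSpecIso (.of k)).symm.commRingCatIsoToRingEquiv hstd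
  have hk : (p : k) = 0 := CharP.cast_eq_zero k p
  have hA := natCast_sections_eq_zero h V
  have hfin : φ.FiniteType := .of_finitePresentation hφ.smooth.finitePresentation
  have : IsNoetherianRing Γ(X, V) := by
    algebraize [φ]
    exact Algebra.FiniteType.isNoetherianRing k _
  have hsurj : Function.Surjective fun x : k => x ^ p :=
    fun a => IsAlgClosed.exists_pow_nat_eq a hp.out.pos
  obtain ⟨s, hs, N, b, hb⟩ := exists_isBasisAlong_localization
    (finite_powRingHom_of_finiteType hfin p hsurj hk hA)
    (flat_powRingHom_of_isStandardSmooth hφ p hk hA)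
    ((IsLocalRing.maximalIdeal (X.presheaf.stalk x)).comap (X.presheaf.germ V x hxV).hom)
  rw [← mem_basicOpen_iff_notMem_comap_germ] at hs
  have hUV : X.basicOpen s ⊓ U₀ ≤ V := inf_le_left.trans (X.basicOpen_le s)
  refine ⟨X.basicOpen s ⊓ U₀, inf_le_right, ⟨hs, hx⟩, N,
    fun i => (X.presheaf.map (homOfLE hUV).op).hom (b i), fun V' hV' y hy => ?_⟩
  obtain ⟨t, ht, hyt⟩ := hV.exists_basicOpen_le ⟨y, hy⟩ (hUV (hV' hy))
  -- One ring of sections, over the basic open set of `t`, must serve as the localization both at `g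
  -- = s * t` and at its image `g ^ p`; all three elements have the same basic open set.
  have hst : X.basicOpen t = X.basicOpen (s * t) := by
    rw [Scheme.basicOpen_mul]
    exact (inf_eq_right.mpr (ht.trans (hV'.trans inf_le_left))).symm
  have hstp : X.basicOpen t = X.basicOpen (powRingHom p hA (s * t)) := by
    rw [hst]
    exact (X.basicOpen_pow _ hp.out.pos).symm
  refine ⟨X.basicOpen t, ht, hyt, ht.trans hV', ?_⟩
  let i := homOfLE (X.basicOpen_le t)
  let _ := (X.presheaf.map i.op).hom.toAlgebra
  have := hV.isLocalization_of_eq_basicOpen _ i hst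
  have := hV.isLocalization_of_eq_basicOpen _ i hstp
  convert hb (s * t) ⟨t, rfl⟩ Γ(X, X.basicOpen t) Γ(X, X.basicOpen t)
    (powRingHom p (natCast_sections_eq_zero h _))
    (RingHom.ext fun x => (map_pow (X.presheaf.map i.op).hom x p).symm) using 2
  rw [← CommRingCat.comp_apply, ← Functor.map_comp]
  rfl

end FrobeniusBasis

/-! ### Morphisms that are bijective on a basis of open sets -/

section LocallyBijective

lemma isLocallyBijective_of_basis {X : TopCat.{u}} {P Q : TopCat.Presheaf Ab.{u} X} (f : P ⟶ Q)
    (h : ∀ (V : Opens X) (x : X), x ∈ V → ∃ W ≤ V, x ∈ W ∧ Function.Bijective (f.app (op W))) :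
    Presheaf.IsLocallyInjective (Opens.grothendieckTopology X) f ∧
      Presheaf.IsLocallySurjective (Opens.grothendieckTopology X) f := by
  refine ⟨⟨fun {V} a b hab x hx => ?_⟩, ⟨fun {V} s x hx => ?_⟩⟩
  · obtain ⟨W, hWV, hxW, hW⟩ := h V.unop x hx
    refine ⟨W, homOfLE hWV, ?_, hxW⟩
    apply hW.1
    have := congrArg (Q.map (homOfLE hWV).op) hab
    rwa [← NatTrans.naturality_apply, ← NatTrans.naturality_apply] at this
  · obtain ⟨W, hWV, hxW, hW⟩ := h V x hx
    exact ⟨W, homOfLE hWV, hW.2 _, hxW⟩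

/-- The forgetful functor to sheaves of abelian groups reflects isomorphisms, and there locally
bijective morphisms are isomorphisms. -/
lemma isIso_of_bijective_app_basis {X : Scheme.{u}} {M N : X.Modules} (f : M ⟶ N)
    (h : ∀ (V : X.Opens) (x : X), x ∈ V → ∃ W ≤ V, x ∈ W ∧ Function.Bijective (f.app W)) :
    IsIso f := by
  obtain ⟨h1, h2⟩ := isLocallyBijective_of_basis f.mapPresheaf h
  have h3 : IsIso ((SheafOfModules.toSheaf X.ringCatSheaf).map f) :=
    Sheaf.isLocallyBijective_iff_isIso _ |>.1 ⟨h1, h2⟩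
  exact isIso_of_reflects_iso (C := SheafOfModules X.ringCatSheaf) f
    (SheafOfModules.toSheaf X.ringCatSheaf)

end LocallyBijective

/-! ### Sections of free sheaves of modules -/

section Free

open Limits SheafOfModules

variable {X : Scheme.{u}} {I : Type u}

variable (X) in
/-- The structure sheaf as a sheaf of modules. -/
def unitModule : X.Modules := SheafOfModules.unit X.ringCatSheaf

variable (X I) in
/-- The free sheaf of modules on `I`. -/
def freeModule : X.Modules := SheafOfModules.free (R := X.ringCatSheaf) I

/-- The value on `V` of a global section. -/
def evalSection {M : X.Modules} (s : SheafOfModules.sections M) (V : X.Opens) : Γ(M, V) :=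
  s.val (op V)

lemma app_evalSection {M N : X.Modules} (f : M ⟶ N) (s : SheafOfModules.sections M)
    (V : X.Opens) : f.app V (evalSection s V) = evalSection (M := N) (sectionsMap f s) V := rfl

variable (X) in
/-- The `i`-th inclusion of the structure sheaf into a free sheaf of modules. -/
def freeIncl (i : I) : unitModule X ⟶ freeModule X I := ιFree (R := X.ringCatSheaf) i

variable (X) in
/-- The `i`-th coordinate of a free sheaf of modules. -/
def freeProj [DecidableEq I] (i : I) : freeModule X I ⟶ unitModule X :=
  Limits.Sigma.desc (C := SheafOfModules X.ringCatSheaf)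
    fun j => (if j = i then 𝟙 (unitModule X) else 0 : unitModule X ⟶ unitModule X)

/-- The `i`-th basis section of a free sheaf of modules over `V`. -/
def freeBasis (i : I) (V : X.Opens) : Γ(freeModule X I, V) :=
  evalSection (M := freeModule X I) (freeSection i) V

lemma freeIncl_freeProj [DecidableEq I] (i j : I) :
    freeIncl X j ≫ freeProj X i = if j = i then 𝟙 _ else 0 :=
  Sigma.ι_desc (C := SheafOfModules X.ringCatSheaf)
    (fun j => (if j = i then 𝟙 (unitModule X) else 0 : unitModule X ⟶ unitModule X)) j

lemma sum_freeProj_freeIncl [Fintype I] [DecidableEq I] :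
    ∑ i, freeProj X i ≫ freeIncl X i = 𝟙 (freeModule X I) := by
  refine Sigma.hom_ext (C := SheafOfModules X.ringCatSheaf) _ _ fun j => ?_
  change freeIncl X j ≫ _ = freeIncl X j ≫ _
  simp only [Preadditive.comp_sum, ← Category.assoc, freeIncl_freeProj]
  rw [Finset.sum_eq_single j] <;> simp +contextual [eq_comm]

lemma freeIncl_app_apply (i : I) (V : X.Opens) (a : Γ(X, V)) :
    (freeIncl X i).app V a = a • freeBasis i V := by
  have h := (freeIncl X i).app_smul a (show Γ(unitModule X, V) from (1 : Γ(X, V)))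
  refine Eq.trans ?_ h
  exact congrArg ((freeIncl X i).app V) (mul_one a).symm

lemma freeProj_app_freeBasis [DecidableEq I] (i j : I) (V : X.Opens) :
    (freeProj X i).app V (freeBasis j V) = (if j = i then 1 else 0 : Γ(X, V)) := by
  have h : (freeProj X i).app V ((freeIncl X j).app V (1 : Γ(X, V))) =
      (freeIncl X j ≫ freeProj X i).app V (1 : Γ(X, V)) := rfl
  rw [freeIncl_freeProj, freeIncl_app_apply, one_smul] at h
  rw [h]
  split_ifs <;> rfl

/-- The free sheaf is an abstract coproduct. For finite `I` it is a biproduct, so the projections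
supply coordinates, and evaluating `sum_freeProj_freeIncl` on a section shows that they recover it.
-/
lemma bijective_freeBasis [Fintype I] (V : X.Opens) :
    Function.Bijective fun a : I → Γ(X, V) => ∑ i, a i • freeBasis i V := by
  classical
  refine Function.bijective_iff_has_inverse.2
    ⟨fun z i => (freeProj X i).app V z, fun a => ?_, fun z => ?_⟩
  · ext i
    simp only [map_sum, Scheme.Modules.Hom.app_smul, freeProj_app_freeBasis]
    refine (Finset.sum_eq_single i ?_ ?_).trans ?_
    · intro j _ hj
      rw [if_neg hj]
      exact mul_zero (a j)
    · simp
    · rw [if_pos rfl]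
      exact mul_one (a i)
  · let ev : (freeModule X I ⟶ freeModule X I) →+ Γ(freeModule X I, V) :=
      { toFun := fun f => f.app V z
        map_zero' := rfl
        map_add' := fun _ _ => rfl }
    have h := congrArg ev (sum_freeProj_freeIncl (X := X) (I := I))
    rw [map_sum] at h
    refine Eq.trans (Finset.sum_congr rfl fun i _ => ?_) h
    exact (freeIncl_app_apply i V _).symm

lemma bijective_app_iff [Fintype I] {M : X.Modules} (f : freeModule X I ⟶ M) (V : X.Opens) :
    Function.Bijective (f.app V) ↔
      Function.Bijective fun a : I → Γ(X, V) => ∑ i, a i • f.app V (freeBasis i V) := by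
  rw [← Function.Bijective.of_comp_iff _ (bijective_freeBasis V)]
  refine iff_of_eq (congrArg _ (funext fun a => ?_))
  simp

/-- The morphism from a free sheaf of modules given by sections. -/
def freeDesc {M : X.Modules} (s : I → SheafOfModules.sections M) : freeModule X I ⟶ M :=
  (SheafOfModules.freeHomEquiv (R := X.ringCatSheaf) M).symm s

lemma freeDesc_app_freeBasis {M : X.Modules} (s : I → SheafOfModules.sections M) (i : I)
    (V : X.Opens) : (freeDesc s).app V (freeBasis i V) = evalSection (s i) V :=
  (app_evalSection (freeDesc s) _ _).trans (congrArg (evalSection (M := M) · V)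
    (sectionsMap_freeHomEquiv_symm_freeSection (R := X.ringCatSheaf) (M := M) s i))

lemma freeBasis_res (i : I) {V W : X.Opens} (h : W ≤ V) :
    (freeModule X I).presheaf.map (homOfLE h).op (freeBasis i V) = freeBasis i W :=
  (freeSection (R := X.ringCatSheaf) i).2 (homOfLE h).op

end Free

/-! ### Vector bundles in terms of local bases -/

section VectorBundle

variable {X : Scheme.{u}}

/-- The sections `s` of `M` over `U` restrict to a basis of `M(W)`. -/
def IsBasisOver {I : Type*} [Fintype I] (M : X.Modules) {U : X.Opens} (s : I → Γ(M, U))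
    {W : X.Opens} (hW : W ≤ U) : Prop :=
  Function.Bijective fun a : I → Γ(X, W) => ∑ i, a i • M.presheaf.map (homOfLE hW).op (s i)

lemma smul_restrict_ι (E : X.Modules) (U : X.Opens) (W : (U : Scheme.{u}).Opens)
    (a : Γ((U : Scheme.{u}), W)) (x : Γ(E.restrict U.ι, W)) :
    a • x = (show Γ(E, U.ι ''ᵁ W) from
      (show Γ(X, U.ι ''ᵁ W) from a) • (show Γ(E, U.ι ''ᵁ W) from x)) := by
  refine (Scheme.Modules.smul_restrictAppIso_hom_apply U.ι E W a x).trans ?_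
  simp [Scheme.Opens.ι_appIso]
  rfl

lemma bijective_restrict_ι {I : Type*} [Fintype I] (E : X.Modules) (U : X.Opens)
    (W : (U : Scheme.{u}).Opens) (z : I → Γ(E, U.ι ''ᵁ W)) :
    (Function.Bijective fun a : I → Γ((U : Scheme.{u}), W) =>
      ∑ i, a i • (show Γ(E.restrict U.ι, W) from z i)) ↔
    Function.Bijective fun a : I → Γ(X, U.ι ''ᵁ W) => ∑ i, a i • z i :=
  iff_of_eq (congrArg Function.Bijective
    (funext fun a => Finset.sum_congr rfl fun i _ => smul_restrict_ι E U W (a i) (z i)))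

lemma IsVectorBundle.exists_isBasisOver {E : X.Modules} (hE : IsVectorBundle E) (x : X) :
    ∃ (U : X.Opens) (_ : x ∈ U) (r : ℕ) (s : ULift.{u} (Fin r) → Γ(E, U)),
      ∀ (W : X.Opens) (hW : W ≤ U), IsBasisOver E s hW := by
  obtain ⟨U, hx, r, ⟨e⟩⟩ := hE x
  replace e : E.restrict U.ι ≅ freeModule (U : Scheme.{u}) (ULift.{u} (Fin r)) := e
  let s (i : ULift.{u} (Fin r)) : Γ(E, U.ι ''ᵁ ⊤) := e.inv.app ⊤ (freeBasis i ⊤)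
  -- The open set is `U.ι ''ᵁ ⊤` rather than `U`, because its sections of `E` are by definition the
  -- global sections of the restriction.
  refine ⟨U.ι ''ᵁ ⊤, by simpa using hx, r, s, fun W hW => ?_⟩
  obtain ⟨W, rfl⟩ : ∃ W' : (U : Scheme.{u}).Opens, U.ι ''ᵁ W' = W :=
    ⟨U.ι ⁻¹ᵁ W, by simpa [Scheme.Hom.image_preimage_eq_opensRange_inf] using hW⟩
  refine (bijective_restrict_ι E U W _).1 ?_
  have h1 : Function.Bijective (e.inv.app W) := by
    rw [← ConcreteCategory.isIso_iff_bijective]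
    infer_instance
  rw [bijective_app_iff] at h1
  convert! h1 using 5 with a i
  rw [← freeBasis_res i le_top]
  exact (NatTrans.naturality_apply e.inv.mapPresheaf (homOfLE le_top : W ⟶ ⊤).op _).symm

/-- Bases are required only over arbitrarily small `W`, since an isomorphism of sheaves can be
tested locally. This is the form in which Frobenius bases are available. -/
lemma isVectorBundle_of_isBasisOver {E : X.Modules}
    (h : ∀ x : X, ∃ (U : X.Opens) (_ : x ∈ U) (r : ℕ) (s : ULift.{u} (Fin r) → Γ(E, U)),
      ∀ V ≤ U, ∀ y ∈ V, ∃ (W : X.Opens) (_ : W ≤ V) (_ : y ∈ W) (hW : W ≤ U),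
        IsBasisOver E s hW) : IsVectorBundle E := by
  intro x
  obtain ⟨U, hx, r, s, hs⟩ := h x
  refine ⟨U, hx, r, ⟨?_⟩⟩
  let t (i : ULift.{u} (Fin r)) : SheafOfModules.sections (E.restrict U.ι) :=
    PresheafOfModules.sectionsMk
      (fun V => E.presheaf.map (homOfLE (U.ι_image_le V.unop)).op (s i)) fun V W f => by
        change E.presheaf.map _ (E.presheaf.map _ _) = _
        rw [← CategoryTheory.comp_apply, ← Functor.map_comp]
        rfl
  have : IsIso (freeDesc t) := by
    refine isIso_of_bijective_app_basis _ fun V y hy => ?_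
    obtain ⟨W, hWV, hyW, hWU, hW⟩ := hs (U.ι ''ᵁ V) (U.ι_image_le V) y.1 (U.mem_ι_image_iff.2 hy)
    obtain ⟨W, rfl⟩ : ∃ W' : (U : Scheme.{u}).Opens, U.ι ''ᵁ W' = W :=
      ⟨U.ι ⁻¹ᵁ W, by simpa [Scheme.Hom.image_preimage_eq_opensRange_inf] using hWU⟩
    refine ⟨W, fun z hz => U.mem_ι_image_iff.1 (hWV (U.mem_ι_image_iff.2 hz)),
      U.mem_ι_image_iff.1 hyW, ?_⟩
    rw [bijective_app_iff]
    simp only [freeDesc_app_freeBasis]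
    exact (bijective_restrict_ι E U W _).2 hW
  exact (asIso (freeDesc t)).symm

end VectorBundle

/-! ### The Frobenius push-forward of a vector bundle -/

section PushforwardVectorBundle

variable {X : Scheme.{u}} (p : ℕ) [Fact p.Prime] (h : (p : Γ(X, ⊤)) = 0)

/-- The push-forward of a sheaf of modules along the absolute Frobenius. -/
abbrev frobeniusPushforward (E : X.Modules) : X.Modules :=
  (Scheme.Modules.pushforward (absFrobenius X p h)).obj E

/-- The local basis consists of the products `b_j • s_i`, with `b` a basis of `𝒪_X` over its `p`-th
powers and `s` a basis of `E`. -/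
lemma isVectorBundle_frobeniusPushforward {k : Type u} [Field k] [IsAlgClosed k] [CharP k p]
    (f : X ⟶ Spec (.of k)) [Smooth f] {E : X.Modules} (hE : IsVectorBundle E) :
    IsVectorBundle (frobeniusPushforward p h E) := by
  refine isVectorBundle_of_isBasisOver fun x => ?_
  obtain ⟨U₀, hx, r, s, hs⟩ := hE.exists_isBasisOver x
  obtain ⟨U, hU, hxU, N, b, hb⟩ := exists_isBasisAlong_powRingHom p f h x U₀ hx
  let e : ULift.{u} (Fin (N * r)) ≃ Fin N × ULift.{u} (Fin r) :=
    Equiv.ulift.trans (finProdFinEquiv.symm.trans (.prodCongr (.refl _) Equiv.ulift.symm))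
  let t (z : Fin N × ULift.{u} (Fin r)) : Γ(E, U) :=
    b z.1 • E.presheaf.map (homOfLE hU).op (s z.2)
  refine ⟨U, hxU, N * r, fun z => t (e z), fun V hV y hy => ?_⟩
  obtain ⟨W, hWV, hyW, hWU, hW⟩ := hb V hV y hy
  refine ⟨W, hWV, hyW, hWU, ?_⟩
  have h1 := hs W (hWU.trans hU)
  let c : (ULift.{u} (Fin (N * r)) → Γ(X, W)) ≃ (ULift.{u} (Fin r) → Fin N → Γ(X, W)) :=
    (Equiv.arrowCongr e (.refl _)).trans ((Equiv.curry _ _ _).trans (Equiv.piComm _))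
  refine (congrArg Function.Bijective (funext fun a => ?_)).mp
    -- For each `i` the coefficients are first collected into `∑ j, a ^ p * b j`, then these are
    -- combined along `s`; both stages are bijective.
    (h1.comp ((Function.Bijective.piMap fun _ => hW).comp c.bijective))
  change (∑ i, (∑ j, a (e.symm (j, i)) ^ p *
    (X.presheaf.map (homOfLE hWU).op).hom (b j)) • E.presheaf.map (homOfLE (hWU.trans hU)).op (s i))
    = ∑ z, (show Γ(E, W) from a z ^ p • E.presheaf.map (homOfLE hWU).op (t (e z)))
  rw [← e.symm.sum_comp, Fintype.sum_prod_type_right]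
  refine Finset.sum_congr rfl fun i _ => ?_
  rw [Finset.sum_smul]
  refine Finset.sum_congr rfl fun j _ => ?_
  rw [mul_smul, Equiv.apply_symm_apply]
  refine congrArg (_ • ·) ?_
  refine Eq.trans ?_ (E.map_smul (homOfLE hWU) _ _).symm
  refine congrArg (_ • ·) ?_
  rw [← CategoryTheory.comp_apply, ← Functor.map_comp]
  rfl

end PushforwardVectorBundle

/-! ### Local generators and pull-back -/

section Generator

variable {X Y : Scheme.{u}}

/-- A morphism of sheaves of modules given by its values on sections. -/
def homMk {A B : X.Modules} (φ : ∀ W : X.Opens, Γ(A, W) → Γ(B, W))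
    (hadd : ∀ W x y, φ W (x + y) = φ W x + φ W y)
    (hsmul : ∀ (W : X.Opens) (a : Γ(X, W)) (x : Γ(A, W)), φ W (a • x) = a • φ W x)
    (hres : ∀ (V W : X.Opens) (i : W ⟶ V) (x : Γ(A, V)),
      φ W (A.presheaf.map i.op x) = B.presheaf.map i.op (φ V x)) : A ⟶ B :=
  SheafOfModules.Hom.mk
    { app := fun W => ModuleCat.ofHom
        (X := A.val.obj W) (Y := B.val.obj W)
        { toFun := φ W.unop
          map_add' := hadd W.unop
          map_smul' := hsmul W.unop }
      naturality := fun {V W} i => by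
        ext x
        exact hres _ _ i.unop x }

lemma app_res {A B : X.Modules} (f : A ⟶ B) {V W : X.Opens} (i : W ⟶ V) (x : Γ(A, V)) :
    f.app W (A.presheaf.map i.op x) = B.presheaf.map i.op (f.app V x) :=
  NatTrans.naturality_apply f.mapPresheaf i.op x

lemma res_res (A : X.Modules) {U V W : X.Opens} (i : V ⟶ U) (j : W ⟶ V) (l : W ⟶ U)
    (x : Γ(A, U)) :
    A.presheaf.map j.op (A.presheaf.map i.op x) = A.presheaf.map l.op x := by
  rw [← CategoryTheory.comp_apply, ← Functor.map_comp]
  rfl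

/-- The section `s` of `M` over `V` freely generates the restriction of `M` to `V`. -/
def IsGenerator (M : X.Modules) {V : X.Opens} (s : Γ(M, V)) : Prop :=
  ∀ (W : X.Opens) (i : W ⟶ V), Function.Bijective fun a : Γ(X, W) => a • M.presheaf.map i.op s

/-- The restriction of `N` to `U`, extended to `X` by push-forward. -/
def restrictExtend (N : X.Modules) (U : X.Opens) : X.Modules :=
  (Scheme.Modules.pushforward U.ι).obj (N.restrict U.ι)

/-- The open set `U ∩ W`, as it occurs in the sections of `restrictExtend N U`. -/
abbrev capOpen (U W : X.Opens) : X.Opens := U.ι ''ᵁ U.ι ⁻¹ᵁ W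

def capOpenLeft (U W : X.Opens) : capOpen U W ⟶ U := homOfLE (U.ι_image_le _)

def capOpenRight (U W : X.Opens) : capOpen U W ⟶ W := homOfLE (U.ι.image_preimage_le W)

def capOpenMap (U : X.Opens) {V W : X.Opens} (i : W ⟶ V) : capOpen U W ⟶ capOpen U V :=
  homOfLE (U.ι.image_mono (U.ι.preimage_mono i.le))

/-- The sections of `restrictExtend N U` over `W` are the sections of `N` over `U ∩ W`. -/
def capSection (N : X.Modules) (U W : X.Opens) :
    Γ(restrictExtend N U, W) ≃+ Γ(N, capOpen U W) := AddEquiv.refl _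

lemma capSection_smul (N : X.Modules) (U W : X.Opens) (a : Γ(X, W))
    (x : Γ(restrictExtend N U, W)) :
    capSection N U W (a • x) = X.presheaf.map (capOpenRight U W).op a • capSection N U W x :=
  smul_restrict_ι N U _ _ _

lemma capSection_res (N : X.Modules) (U : X.Opens) {V W : X.Opens} (i : W ⟶ V)
    (x : Γ(restrictExtend N U, V)) :
    capSection N U W ((restrictExtend N U).presheaf.map i.op x) =
      N.presheaf.map (capOpenMap U i).op (capSection N U V x) := rfl

/-- The sections of the structure sheaf as a sheaf of modules. -/
def unitSection (W : X.Opens) : Γ(unitModule X, W) ≃+ Γ(X, W) := AddEquiv.refl _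

lemma unitSection_smul (W : X.Opens) (a : Γ(X, W)) (x : Γ(unitModule X, W)) :
    unitSection W (a • x) = a * unitSection W x := rfl

lemma unitSection_res {V W : X.Opens} (i : W ⟶ V) (x : Γ(unitModule X, V)) :
    unitSection W ((unitModule X).presheaf.map i.op x) = X.presheaf.map i.op (unitSection V x) :=
  rfl

/-- The restriction morphism from `N` to `restrictExtend N U`. -/
def toRestrictExtend (N : X.Modules) (U : X.Opens) : N ⟶ restrictExtend N U :=
  (Scheme.Modules.restrictAdjunction U.ι).unit.app N

lemma toRestrictExtend_app (N : X.Modules) (U W : X.Opens) (x : Γ(N, W)) :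
    capSection N U W ((toRestrictExtend N U).app W x) =
      N.presheaf.map (capOpenRight U W).op x := rfl

/-- Multiplication by a section over `U`, as a morphism from the structure sheaf of `U`. -/
def mulSection (N : X.Modules) {U : X.Opens} (t : Γ(N, U)) :
    restrictExtend (unitModule X) U ⟶ restrictExtend N U :=
  homMk (fun W a => (capSection N U W).symm (unitSection _ (capSection _ U W a) •
      N.presheaf.map (capOpenLeft U W).op t))
    (fun W a b => by rw [← map_add, map_add, map_add, add_smul])
    (fun W a b => by
      apply (capSection N U W).injective
      rw [capSection_smul, capSection_smul, AddEquiv.apply_symm_apply, AddEquiv.apply_symm_apply,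
        unitSection_smul, mul_smul])
    (fun V W i a => by
      apply (capSection N U W).injective
      rw [capSection_res, capSection_res, AddEquiv.apply_symm_apply, AddEquiv.apply_symm_apply,
        Scheme.Modules.map_smul, res_res N _ _ (capOpenLeft U W), unitSection_res])

lemma mulSection_app (N : X.Modules) {U : X.Opens} (t : Γ(N, U)) (W : X.Opens)
    (a : Γ(restrictExtend (unitModule X) U, W)) :
    capSection N U W ((mulSection N t).app W a) =
      unitSection _ (capSection _ U W a) • N.presheaf.map (capOpenLeft U W).op t := rfl

variable {M : Y.Modules} {V : Y.Opens} {s : Γ(M, V)}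

/-- The coordinate of a section with respect to a generator. -/
def IsGenerator.coord (hs : IsGenerator M s) {W : Y.Opens} (i : W ⟶ V) (m : Γ(M, W)) : Γ(Y, W) :=
  (Equiv.ofBijective _ (hs W i)).symm m

lemma IsGenerator.coord_smul (hs : IsGenerator M s) {W : Y.Opens} (i : W ⟶ V) (m : Γ(M, W)) :
    hs.coord i m • M.presheaf.map i.op s = m :=
  (Equiv.ofBijective _ (hs W i)).apply_symm_apply m

lemma IsGenerator.coord_eq (hs : IsGenerator M s) {W : Y.Opens} (i : W ⟶ V) {m : Γ(M, W)}
    {a : Γ(Y, W)} (h : a • M.presheaf.map i.op s = m) : hs.coord i m = a :=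
  (hs W i).1 ((hs.coord_smul i m).trans h.symm)

lemma IsGenerator.coord_add (hs : IsGenerator M s) {W : Y.Opens} (i : W ⟶ V) (m n : Γ(M, W)) :
    hs.coord i (m + n) = hs.coord i m + hs.coord i n :=
  hs.coord_eq i (by rw [add_smul, coord_smul, coord_smul])

lemma IsGenerator.coord_smul_right (hs : IsGenerator M s) {W : Y.Opens} (i : W ⟶ V) (a : Γ(Y, W))
    (m : Γ(M, W)) : hs.coord i (a • m) = a * hs.coord i m :=
  hs.coord_eq i (by rw [mul_smul, coord_smul])

lemma IsGenerator.coord_res (hs : IsGenerator M s) {W W' : Y.Opens} (i : W ⟶ V) (j : W' ⟶ W)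
    (l : W' ⟶ V) (m : Γ(M, W)) :
    hs.coord l (M.presheaf.map j.op m) = Y.presheaf.map j.op (hs.coord i m) :=
  hs.coord_eq l (by
    rw [← res_res M i j l, ← Scheme.Modules.map_smul, coord_smul])

variable (f : X ⟶ Y)

lemma capOpen_le_preimage (V W : Y.Opens) :
    capOpen (f ⁻¹ᵁ V) (f ⁻¹ᵁ W) ≤ f ⁻¹ᵁ capOpen V W := by
  simp only [capOpen, Scheme.Hom.image_preimage_eq_opensRange_inf, Scheme.Opens.opensRange_ι]
  exact le_rfl

/-- The effect of `f^♯` on sections over `V ∩ W`. -/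
def capAppLE (V W : Y.Opens) (a : Γ(Y, capOpen V W)) : Γ(X, capOpen (f ⁻¹ᵁ V) (f ⁻¹ᵁ W)) :=
  f.appLE _ _ (capOpen_le_preimage f V W) a

/-- Sections of a push-forward. -/
def pushSection (N : X.Modules) (W : Y.Opens) :
    Γ((Scheme.Modules.pushforward f).obj N, W) ≃+ Γ(N, f ⁻¹ᵁ W) := AddEquiv.refl _

/-- The sections over `W` of the push-forward of the structure sheaf of `f ⁻¹ V`. -/
def pushCapSection (V W : Y.Opens) :
    Γ((Scheme.Modules.pushforward f).obj (restrictExtend (unitModule X) (f ⁻¹ᵁ V)), W) ≃+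
      Γ(X, capOpen (f ⁻¹ᵁ V) (f ⁻¹ᵁ W)) :=
  ((pushSection f _ W).trans (capSection _ _ _)).trans (unitSection _)

lemma pushCapSection_smul (V W : Y.Opens) (a : Γ(Y, W))
    (x : Γ((Scheme.Modules.pushforward f).obj (restrictExtend (unitModule X) (f ⁻¹ᵁ V)), W)) :
    pushCapSection f V W (a • x) =
      X.presheaf.map (capOpenRight _ _).op (f.app W a) * pushCapSection f V W x :=
  congrArg (unitSection _)
    (capSection_smul (unitModule X) (f ⁻¹ᵁ V) (f ⁻¹ᵁ W) (f.app W a) (pushSection f _ W x))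

lemma section_res_res {U V W : X.Opens} (i : V ⟶ U) (j : W ⟶ V) (l : W ⟶ U) (x : Γ(X, U)) :
    X.presheaf.map j.op (X.presheaf.map i.op x) = X.presheaf.map l.op x := by
  rw [← CategoryTheory.comp_apply, ← Functor.map_comp]
  rfl

lemma appLE_res {V V' : Y.Opens} {W W' : X.Opens} (e : W ≤ f ⁻¹ᵁ V) (e' : W' ≤ f ⁻¹ᵁ V')
    (i : V' ⟶ V) (j : W' ⟶ W) (a : Γ(Y, V)) :
    f.appLE V' W' e' (Y.presheaf.map i.op a) = X.presheaf.map j.op (f.appLE V W e a) := by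
  rw [← CategoryTheory.comp_apply, ← CategoryTheory.comp_apply, Scheme.Hom.map_appLE,
    Scheme.Hom.appLE_map]

lemma app_eq_appLE (V : Y.Opens) (a : Γ(Y, V)) : f.app V a = f.appLE V (f ⁻¹ᵁ V) le_rfl a := by
  rw [Scheme.Hom.app_eq_appLE]

/-- The coordinate map of a generator, followed by `f^♯`. -/
def IsGenerator.coordHom (hs : IsGenerator M s) :
    M ⟶ (Scheme.Modules.pushforward f).obj (restrictExtend (unitModule X) (f ⁻¹ᵁ V)) :=
  homMk (fun W m => (pushCapSection f V W).symm (capAppLE f V W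
      (hs.coord (capOpenLeft V W) (M.presheaf.map (capOpenRight V W).op m))))
    (fun W m n => by rw [← map_add, capAppLE, map_add, coord_add, map_add]; rfl)
    (fun W a m => by
      apply (pushCapSection f V W).injective
      rw [AddEquiv.apply_symm_apply, Scheme.Modules.map_smul, coord_smul_right, capAppLE, map_mul,
        appLE_res f le_rfl _ _ (capOpenRight _ _), ← app_eq_appLE]
      exact (pushCapSection_smul f V W a _).symm)
    (fun W W' i m => by
      apply (pushCapSection f V W').injective
      rw [AddEquiv.apply_symm_apply, res_res M _ _ (capOpenMap V i ≫ capOpenRight V W),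
        ← res_res M (capOpenRight V W) (capOpenMap V i), hs.coord_res (capOpenLeft V W), capAppLE,
        appLE_res f (capOpen_le_preimage f V W) _ _
          (capOpenMap (f ⁻¹ᵁ V) ((Opens.map f.base).map i))]
      rfl)

lemma IsGenerator.coordHom_app (hs : IsGenerator M s) (W : Y.Opens) (m : Γ(M, W)) :
    pushCapSection f V W ((hs.coordHom f).app W m) = f.appLE _ _ (capOpen_le_preimage f V W)
      (hs.coord (capOpenLeft V W) (M.presheaf.map (capOpenRight V W).op m)) := rfl

/-- The unit of the adjunction between pull-back and push-forward. -/
def pullbackUnit (M : Y.Modules) :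
    M ⟶ (Scheme.Modules.pushforward f).obj ((Scheme.Modules.pullback f).obj M) :=
  (Scheme.Modules.pullbackPushforwardAdjunction f).unit.app M

/-- The pull-back of a section. -/
def pullbackSection (M : Y.Modules) {V : Y.Opens} (s : Γ(M, V)) :
    Γ((Scheme.Modules.pullback f).obj M, f ⁻¹ᵁ V) :=
  pushSection f _ V ((pullbackUnit f M).app V s)

lemma pullbackSection_res (M : Y.Modules) {V W : Y.Opens} (i : W ⟶ V) (s : Γ(M, V)) :
    pullbackSection f M (M.presheaf.map i.op s) =
      ((Scheme.Modules.pullback f).obj M).presheaf.map ((Opens.map f.base).map i).op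
        (pullbackSection f M s) :=
  congrArg (pushSection f _ W) (app_res (pullbackUnit f M) i s)

lemma pullbackSection_smul (M : Y.Modules) {V : Y.Opens} (a : Γ(Y, V)) (s : Γ(M, V)) :
    pullbackSection f M (a • s) = f.app V a • pullbackSection f M s := by
  rw [pullbackSection, Scheme.Modules.Hom.app_smul]
  rfl

lemma homEquiv_symm_app_pullbackSection {M : Y.Modules} {N : X.Modules}
    (g : M ⟶ (Scheme.Modules.pushforward f).obj N) {V : Y.Opens} (s : Γ(M, V)) :
    (((Scheme.Modules.pullbackPushforwardAdjunction f).homEquiv _ _).symm g).app (f ⁻¹ᵁ V)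
      (pullbackSection f M s) = pushSection f N V (g.app V s) := by
  have h := ((Scheme.Modules.pullbackPushforwardAdjunction f).homEquiv _ _).apply_symm_apply g
  rw [Adjunction.homEquiv_unit] at h
  conv_rhs => rw [← h]
  rfl

/-- By adjunction, pulled-back sections detect morphisms out of a pull-back, whose general sections
have no explicit description. -/
lemma pullback_hom_ext {M : Y.Modules} {N : X.Modules}
    {g g' : (Scheme.Modules.pullback f).obj M ⟶ N}
    (h : ∀ (V : Y.Opens) (s : Γ(M, V)),
      g.app (f ⁻¹ᵁ V) (pullbackSection f M s) = g'.app (f ⁻¹ᵁ V) (pullbackSection f M s)) :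
    g = g' := by
  apply ((Scheme.Modules.pullbackPushforwardAdjunction f).homEquiv _ _).injective
  rw [Adjunction.homEquiv_unit, Adjunction.homEquiv_unit]
  ext V s
  exact h V s

/-- Only the universal property of the pull-back is used. The coordinate map of `s` followed by
`f^♯` has an adjoint `c`, from the pull-back to the structure sheaf of `U = f ⁻¹ᵁ V` extended to
`X`. Since `c` sends the pulled-back section `t` to `1`, multiplication by `t` is injective. Since
`c` followed by multiplication by `t` is restriction to `U`, it is surjective. Extending from `U` to
`X` lets the adjunction for `f` itself apply. -/
lemma IsGenerator.pullback (hs : IsGenerator M s) :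
    IsGenerator ((Scheme.Modules.pullback f).obj M) (pullbackSection f M s) := by
  let N := (Scheme.Modules.pullback f).obj M
  let U := f ⁻¹ᵁ V
  let t : Γ(N, U) := pullbackSection f M s
  let c : N ⟶ restrictExtend (unitModule X) U :=
    ((Scheme.Modules.pullbackPushforwardAdjunction f).homEquiv _ _).symm (hs.coordHom f)
  have hc (W : Y.Opens) (m : Γ(M, W)) :
      unitSection _ (capSection _ _ _ (c.app (f ⁻¹ᵁ W) (pullbackSection f M m))) =
      f.appLE _ _ (capOpen_le_preimage f V W)
        (hs.coord (capOpenLeft V W) (M.presheaf.map (capOpenRight V W).op m)) := by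
    rw [homEquiv_symm_app_pullbackSection]
    exact hs.coordHom_app f W m
  have hct : unitSection _ (capSection _ _ _ (c.app U t)) = 1 := by
    rw [hc, hs.coord_eq (a := 1), map_one]
    rw [one_smul]
    rfl
  have key : c ≫ mulSection N t = toRestrictExtend N U := by
    refine pullback_hom_ext f fun W m => (capSection N U _).injective ?_
    rw [Scheme.Modules.Hom.comp_app, CategoryTheory.comp_apply, mulSection_app, hc,
      toRestrictExtend_app]
    let l : capOpen U (f ⁻¹ᵁ W) ⟶ f ⁻¹ᵁ capOpen V W := homOfLE (capOpen_le_preimage f V W)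
    rw [← res_res N ((Opens.map f.base).map (capOpenRight V W)) l, ← pullbackSection_res]
    conv_rhs => rw [← hs.coord_smul (capOpenLeft V W) (M.presheaf.map (capOpenRight V W).op m)]
    rw [pullbackSection_smul, Scheme.Modules.map_smul, pullbackSection_res,
      res_res N _ _ (capOpenLeft U _), app_eq_appLE, ← CategoryTheory.comp_apply,
      Scheme.Hom.appLE_map]
  intro W i
  have hW : capOpen U W = W := by
    simpa [Scheme.Hom.image_preimage_eq_opensRange_inf] using i.le
  -- For `W ≤ U` the open set `capOpen U W` equals `W` but not definitionally; `j` transports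
  -- between them.
  let j : W ⟶ capOpen U W := eqToHom hW.symm
  refine ⟨fun a b hab => ?_, fun z => ?_⟩
  · have hca (a : Γ(X, W)) : unitSection _ (capSection _ _ _ (c.app W (a • N.presheaf.map i.op t))) =
        X.presheaf.map (capOpenRight U W).op a := by
      rw [Scheme.Modules.Hom.app_smul, capSection_smul, app_res, capSection_res, unitSection_smul,
        unitSection_res, hct, map_one, mul_one]
    have hab' := (hca a).symm.trans
      ((congrArg (fun z => unitSection _ (capSection _ _ _ (c.app W z))) hab).trans (hca b))
    have := congrArg (X.presheaf.map j.op) hab'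
    rw [section_res_res _ _ (𝟙 W), section_res_res _ _ (𝟙 W)] at this
    simpa using this
  · refine ⟨X.presheaf.map j.op (unitSection _ (capSection _ _ _ (c.app W z))), ?_⟩
    have hz := congrArg (fun g => N.presheaf.map j.op (capSection N U W (g.app W z))) key
    simp only [Scheme.Modules.Hom.comp_app, CategoryTheory.comp_apply, mulSection_app,
      toRestrictExtend_app, Scheme.Modules.map_smul] at hz
    rw [res_res N _ _ i, res_res N _ _ (𝟙 W)] at hz
    exact hz.trans (by simp)

end Generator

/-! ### Generators and powers of sections of the twisting sheaves -/

section TwistSections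

variable {A σ : Type u} [CommRing A] [SetLike σ A] [AddSubgroupClass σ A]
  {𝒜 : ℕ → σ} [GradedRing 𝒜] {m : ℤ}

/-- The value in `A_𝔭` of a section of `𝒪(m)`. -/
def twistVal {W : (Proj 𝒜).Opens} (s : Γ(twist 𝒜 m, W)) (x : W) : LocAt 𝒜 x.1 :=
  (show twistSections 𝒜 m (op W) from s).1 x

lemma twistVal_ext {W : (Proj 𝒜).Opens} {s t : Γ(twist 𝒜 m, W)}
    (h : ∀ x, twistVal s x = twistVal t x) : s = t :=
  Subtype.ext (funext h)

/-- A section of `𝒪(m)` given by its values. -/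
def twistMk {W : (Proj 𝒜).Opens} (φ : ∀ x : W, LocAt 𝒜 x.1)
    (hφ : (isLocallyTwistedFraction 𝒜 m).pred φ) : Γ(twist 𝒜 m, W) :=
  (⟨φ, hφ⟩ : twistSections 𝒜 m (op W))

/-- The value in `A_𝔭` of a section of the structure sheaf. -/
def structVal {W : (Proj 𝒜).Opens} (a : Γ(Proj 𝒜, W)) (x : W) : LocAt 𝒜 x.1 :=
  ((show (ProjectiveSpectrum.Proj.structureSheaf 𝒜).1.obj (op W) from a).1 x).val

lemma structVal_ext {W : (Proj 𝒜).Opens} {a b : Γ(Proj 𝒜, W)}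
    (h : ∀ x, structVal a x = structVal b x) : a = b :=
  Subtype.ext (funext fun x => HomogeneousLocalization.val_injective _ (h x))

lemma structVal_pow {W : (Proj 𝒜).Opens} (a : Γ(Proj 𝒜, W)) (n : ℕ) (x : W) :
    structVal (a ^ n) x = structVal a x ^ n :=
  HomogeneousLocalization.val_pow _ _

lemma twistVal_smul {W : (Proj 𝒜).Opens} (a : Γ(Proj 𝒜, W)) (s : Γ(twist 𝒜 m, W)) (x : W) :
    twistVal (a • s) x = structVal a x * twistVal s x := rfl

lemma pred_twistVal {W : (Proj 𝒜).Opens} (s : Γ(twist 𝒜 m, W)) :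
    (isLocallyTwistedFraction 𝒜 m).pred (twistVal s) :=
  (show twistSections 𝒜 m (op W) from s).2

lemma fracAt_pow (x : ProjectiveSpectrum 𝒜) (a b : A) (hb) (n : ℕ) :
    fracAt 𝒜 x a b hb ^ n = fracAt 𝒜 x (a ^ n) (b ^ n) (Submonoid.pow_mem _ hb n) :=
  Localization.mk_pow n a _

/-- The `p`-th power of a section of `𝒪(m)`, as a section of `𝒪(p m)`. -/
def twistPow (p : ℕ) {W : (Proj 𝒜).Opens} (s : Γ(twist 𝒜 m, W)) : Γ(twist 𝒜 (p * m), W) :=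
  twistMk (fun x => twistVal s x ^ p) fun x => by
    obtain ⟨V, hxV, i, d, e, ⟨r, hr⟩, ⟨t, ht⟩, hde, w⟩ := pred_twistVal s x
    refine ⟨V, hxV, i, p * d, p * e, ⟨r ^ p, SetLike.pow_mem_graded p hr⟩,
      ⟨t ^ p, SetLike.pow_mem_graded p ht⟩, by push_cast; rw [hde]; ring, fun y => ?_⟩
    obtain ⟨hs, hy⟩ := w y
    exact ⟨Submonoid.pow_mem _ hs p, (congrArg (· ^ p) hy).trans (fracAt_pow y.1 r t hs p)⟩

lemma twistPow_add {p : ℕ} [hp : Fact p.Prime] (h : (p : A) = 0) {W : (Proj 𝒜).Opens}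
    (s t : Γ(twist 𝒜 m, W)) : twistPow p (s + t) = twistPow p s + twistPow p t :=
  twistVal_ext fun x =>
    (powRingHom p (natCast_eq_zero_of_ringHom (algebraMap A (LocAt 𝒜 x.1)) h)).map_add _ _

lemma twistPow_smul (p : ℕ) {W : (Proj 𝒜).Opens} (a : Γ(Proj 𝒜, W)) (s : Γ(twist 𝒜 m, W)) :
    twistPow p (a • s) = a ^ p • twistPow p s :=
  twistVal_ext fun x => by
    rw [twistVal_smul, structVal_pow]
    exact mul_pow _ _ p

variable {f : A} (hf : f ∈ 𝒜 1)

lemma pow_mem_graded_of_one (hf : f ∈ 𝒜 1) (n : ℕ) : f ^ n ∈ 𝒜 n := by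
  simpa using SetLike.pow_mem_graded n hf

variable (m) in
/-- The section `f ^ m` of `𝒪(m)` over the basic open set of an element `f` of degree one. -/
def twistGen : Γ(twist 𝒜 m, ProjectiveSpectrum.basicOpen 𝒜 f) :=
  -- One of the two exponents is zero, so the fraction is `f ^ m` for either sign of `m`.
  twistMk (fun x => fracAt 𝒜 x.1 (f ^ m.toNat) (f ^ (-m).toNat) (Submonoid.pow_mem _ x.2 _))
    fun x => ⟨_, x.2, 𝟙 _, m.toNat, (-m).toNat, ⟨_, pow_mem_graded_of_one hf _⟩,
      ⟨_, pow_mem_graded_of_one hf _⟩, by omega,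
      fun y => ⟨Submonoid.pow_mem _ y.2 _, rfl⟩⟩

lemma toNat_natCast_mul (p : ℕ) (m : ℤ) : (p * m : ℤ).toNat = m.toNat * p := by
  rcases le_total 0 m with h | h
  · obtain ⟨n, rfl⟩ := Int.eq_ofNat_of_zero_le h
    norm_cast
    simp [mul_comm]
  · rw [Int.toNat_of_nonpos h, Int.toNat_of_nonpos (mul_nonpos_of_nonneg_of_nonpos (by simp) h),
      zero_mul]

lemma twistPow_twistGen (p : ℕ) : twistPow p (twistGen m hf) = twistGen (p * m) hf :=
  twistVal_ext fun x => by
    refine (fracAt_pow x.1 _ _ _ p).trans ?_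
    simp only [← pow_mul, ← toNat_natCast_mul, mul_neg]
    rfl

lemma fracAt_mul_swap (x : ProjectiveSpectrum 𝒜) (a b : A) (ha hb) :
    fracAt 𝒜 x a b hb * fracAt 𝒜 x b a ha = 1 := by
  rw [fracAt_mul, fracAt, Localization.mk_eq_mk', IsLocalization.mk'_eq_iff_eq_mul]
  simp [mul_comm]

lemma fracAt_mul_cancel (x : ProjectiveSpectrum 𝒜) (r t a b : A) (ht ha hb) :
    fracAt 𝒜 x (r * b) (t * a) (mul_mem ht ha) * fracAt 𝒜 x a b hb = fracAt 𝒜 x r t ht := by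
  rw [← fracAt_mul 𝒜 x r t b a ht ha, mul_assoc, fracAt_mul_swap, mul_one]

lemma twistVal_twistGen_mul {W : (Proj 𝒜).Opens} (i : W ⟶ ProjectiveSpectrum.basicOpen 𝒜 f)
    (x : W) : ∃ u, twistVal ((twist 𝒜 m).presheaf.map i.op (twistGen m hf)) x * u = 1 :=
  ⟨_, fracAt_mul_swap x.1 _ _ (Submonoid.pow_mem _ (i.le x.2) _) _⟩

/-- The homogeneous localization at a homogeneous prime. -/
abbrev HomLocAt (x : ProjectiveSpectrum 𝒜) : Type u :=
  HomogeneousLocalization.AtPrime 𝒜 x.asHomogeneousIdeal.toIdeal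

/-- The quotient of a fraction of degree `m` by `f ^ m`. -/
def divGen {d e : ℕ} (hde : (d : ℤ) = e + m) (hf : f ∈ 𝒜 1) (r : 𝒜 d) (t : 𝒜 e)
    (x : ProjectiveSpectrum 𝒜) (ht : t.1 ∈ x.asHomogeneousIdeal.toIdeal.primeCompl)
    (hx : f ∈ x.asHomogeneousIdeal.toIdeal.primeCompl) :
    HomogeneousLocalization.NumDenSameDeg 𝒜 x.asHomogeneousIdeal.toIdeal.primeCompl where
  deg := d + (-m).toNat
  -- Numerator and denominator have the same degree because `d = e + m` gives `d + (-m).toNat = e +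
  -- m.toNat`.
  num := ⟨r.1 * f ^ (-m).toNat, SetLike.mul_mem_graded r.2 (pow_mem_graded_of_one hf _)⟩
  den := ⟨t.1 * f ^ m.toNat, by
    rw [show d + (-m).toNat = e + m.toNat by omega]
    exact SetLike.mul_mem_graded t.2 (pow_mem_graded_of_one hf _)⟩
  den_mem := mul_mem ht (Submonoid.pow_mem _ hx _)

/-- At each point of the basic open set `f ^ m` is a unit of the localization, which gives
injectivity. Dividing a local fraction of degree `m` by it leaves a fraction of degree zero, which
gives surjectivity. -/
lemma isGenerator_twistGen : IsGenerator (twist 𝒜 m) (twistGen m hf) := by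
  intro W i
  set g := (twist 𝒜 m).presheaf.map i.op (twistGen m hf) with hg
  have hcancel (x : W) (a b : LocAt 𝒜 x.1) (h : a * twistVal g x = b * twistVal g x) : a = b := by
    obtain ⟨u, hu⟩ := twistVal_twistGen_mul hf i x
    replace hu : twistVal g x * u = 1 := hu
    have := congrArg (· * u) h
    simpa only [mul_assoc, hu, mul_one] using this
  refine ⟨fun a b hab => structVal_ext fun x => hcancel x _ _ ?_, fun h => ?_⟩
  · exact congrArg (twistVal · x) hab
  · have hval {d e : ℕ} (hde : (d : ℤ) = e + m) (r : 𝒜 d) (t : 𝒜 e) (x : W) (ht)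
        (hx : twistVal h x = fracAt 𝒜 x.1 r.1 t.1 ht) :
        (HomogeneousLocalization.mk (divGen hde hf r t x.1 ht (i.le x.2))).val * twistVal g x =
          twistVal h x := by
      rw [hx, HomogeneousLocalization.val_mk]
      exact fracAt_mul_cancel x.1 _ _ _ _ ht (Submonoid.pow_mem _ (i.le x.2) _) _
    have hex (x : W) : ∃ y : HomLocAt (𝒜 := 𝒜) x.1,
        y.val * twistVal g x = twistVal h x := by
      obtain ⟨V, hxV, j, d, e, r, t, hde, w⟩ := pred_twistVal h x
      obtain ⟨ht, hx⟩ := w ⟨x.1, hxV⟩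
      exact ⟨_, hval hde r t x ht hx⟩
    choose c hc using hex
    -- The quotients were chosen point by point, but cancellation makes them unique, so near each
    -- point they agree with a single fraction.
    have hloc : (ProjectiveSpectrum.StructureSheaf.isLocallyFraction 𝒜).pred c := by
      intro x
      obtain ⟨V, hxV, j, d, e, r, t, hde, w⟩ := pred_twistVal h x
      have ht (y : V) := (w y).choose
      refine ⟨V, hxV, j, d + (-m).toNat, (divGen hde hf r t x.1 (ht ⟨x.1, hxV⟩) (i.le x.2)).num,
        (divGen hde hf r t x.1 (ht ⟨x.1, hxV⟩) (i.le x.2)).den,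
        fun y => mul_mem (ht y) (Submonoid.pow_mem _ (i.le (j.le y.2)) _), fun y => ?_⟩
      apply HomogeneousLocalization.val_injective
      apply hcancel ⟨y.1, j.le y.2⟩
      exact (hc _).trans (hval hde r t ⟨y.1, j.le y.2⟩ (ht y) (w y).choose_spec).symm
    exact ⟨(⟨c, hloc⟩ : (ProjectiveSpectrum.Proj.structureSheaf 𝒜).1.obj (op W)),
      twistVal_ext hc⟩

end TwistSections

section ProjectiveSpace

attribute [local instance] MvPolynomial.gradedAlgebra

/-- The variables generate the polynomial ring over its degree-zero part. -/
lemma exists_mem_basicOpen_X {n : ℕ} {k : Type u} [Field k] (x : projectiveSpace n k) :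
    ∃ j : Fin (n + 1), x ∈ ProjectiveSpectrum.basicOpen (polyGrading n k) (MvPolynomial.X j) := by
  have h := Proj.iSup_basicOpen_eq_top' (polyGrading n k)
    (MvPolynomial.X : Fin (n + 1) → MvPolynomial (Fin (n + 1)) k)
    (fun j => ⟨1, MvPolynomial.isHomogeneous_X k j⟩) (by
      refine top_le_iff.1 fun f _ => ?_
      induction f using MvPolynomial.induction_on with
      | C a =>
        exact Subalgebra.algebraMap_mem (Algebra.adjoin (polyGrading n k 0) _)
          ⟨MvPolynomial.C a, MvPolynomial.isHomogeneous_C _ a⟩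
      | add f g hf hg => exact add_mem (hf trivial) (hg trivial)
      | mul_X f j hf => exact mul_mem (hf trivial) (Algebra.subset_adjoin ⟨j, rfl⟩))
  have hx : x ∈ (⊤ : (projectiveSpace n k).Opens) := trivial
  exact Opens.mem_iSup.1 (h.ge hx)

end ProjectiveSpace

/-! ### The `p`-th power map on the pull-backs of the twisting sheaves -/

section Power

variable {X : Scheme.{u}} {n : ℕ} {k : Type u} [Field k] (i : X ⟶ projectiveSpace n k)

/-- The sheaf `𝒪_X(m)`. -/
abbrev pullbackTwist (m : ℤ) : X.Modules :=
  (Scheme.Modules.pullback i).obj (serreTwist n k m)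

variable (p : ℕ)

section

attribute [local instance] MvPolynomial.gradedAlgebra

lemma natCast_mvPolynomial_eq_zero [CharP k p] : (p : MvPolynomial (Fin (n + 1)) k) = 0 :=
  natCast_eq_zero_of_ringHom MvPolynomial.C (CharP.cast_eq_zero k p)

/-- The `p`-th power of a section of `𝒪(m)` on projective space. -/
def serrePow {m : ℤ} {W : (projectiveSpace n k).Opens} (s : Γ(serreTwist n k m, W)) :
    Γ(serreTwist n k (p * m), W) :=
  twistPow (𝒜 := polyGrading n k) p s

lemma serrePow_add [Fact p.Prime] [CharP k p] {m : ℤ} {W : (projectiveSpace n k).Opens}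
    (s t : Γ(serreTwist n k m, W)) : serrePow p (s + t) = serrePow p s + serrePow p t :=
  twistPow_add (𝒜 := polyGrading n k) (natCast_mvPolynomial_eq_zero p) s t

lemma serrePow_smul {m : ℤ} {W : (projectiveSpace n k).Opens} (a : Γ(projectiveSpace n k, W))
    (s : Γ(serreTwist n k m, W)) : serrePow p (a • s) = a ^ p • serrePow p s :=
  twistPow_smul (𝒜 := polyGrading n k) p a s

lemma serrePow_res {m : ℤ} {V W : (projectiveSpace n k).Opens} (j : W ⟶ V)
    (s : Γ(serreTwist n k m, V)) :
    serrePow p ((serreTwist n k m).presheaf.map j.op s) =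
      (serreTwist n k (p * m)).presheaf.map j.op (serrePow p s) := rfl

lemma exists_isGenerator_serreTwist (m : ℤ) (x : projectiveSpace n k) :
    ∃ (V : (projectiveSpace n k).Opens) (_ : x ∈ V) (s : Γ(serreTwist n k m, V)),
      IsGenerator _ s ∧ IsGenerator _ (serrePow p s) := by
  obtain ⟨j, hj⟩ := exists_mem_basicOpen_X x
  have hX : MvPolynomial.X j ∈ polyGrading n k 1 := MvPolynomial.isHomogeneous_X k j
  refine ⟨_, hj, twistGen (𝒜 := polyGrading n k) m hX, isGenerator_twistGen hX, ?_⟩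
  have := isGenerator_twistGen (𝒜 := polyGrading n k) (m := p * m) hX
  rw [← twistPow_twistGen] at this
  exact this

end

variable [hp : Fact p.Prime] (h : (p : Γ(X, ⊤)) = 0)

/-- The `p`-th power map from `𝒪(m)` to the push-forward of `𝒪_X(p m)`. -/
def serrePowHom [CharP k p] (m : ℤ) : serreTwist n k m ⟶
    (Scheme.Modules.pushforward i).obj (frobeniusPushforward p h (pullbackTwist i (p * m))) :=
  homMk (fun W s => pullbackSection i _ (serrePow p s))
    (fun W s t => by
      rw [serrePow_add]
      exact map_add ((pullbackUnit i (serreTwist n k (p * m))).app W).hom _ _)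
    (fun W a s => by
      rw [serrePow_smul, pullbackSection_smul, map_pow]
      rfl)
    (fun V W j s => by
      rw [serrePow_res, pullbackSection_res]
      rfl)

/-- The `p`-th power map from `𝒪_X(m)` to `𝒪_X(p m)`. -/
def powHom [CharP k p] (m : ℤ) :
    pullbackTwist i m ⟶ frobeniusPushforward p h (pullbackTwist i (p * m)) :=
  ((Scheme.Modules.pullbackPushforwardAdjunction i).homEquiv _ _).symm (serrePowHom i p h m)

/-- The `p`-th power of a section of `𝒪_X(m)`. -/
def powSection [CharP k p] {m : ℤ} (U : X.Opens) (s : Γ(pullbackTwist i m, U)) :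
    Γ(pullbackTwist i (p * m), U) :=
  (powHom i p h m).app U s

variable [CharP k p] {m : ℤ}

lemma powSection_add {U : X.Opens} (s t : Γ(pullbackTwist i m, U)) :
    powSection i p h U (s + t) = powSection i p h U s + powSection i p h U t :=
  map_add ((powHom i p h m).app U).hom s t

lemma powSection_smul {U : X.Opens} (a : Γ(X, U)) (s : Γ(pullbackTwist i m, U)) :
    powSection i p h U (a • s) = a ^ p • powSection i p h U s :=
  (powHom i p h m).app_smul a s

lemma powSection_res {U V : X.Opens} (j : V ⟶ U) (s : Γ(pullbackTwist i m, U)) :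
    powSection i p h V ((pullbackTwist i m).presheaf.map j.op s) =
      (pullbackTwist i (p * m)).presheaf.map j.op (powSection i p h U s) :=
  app_res (powHom i p h m) j s

lemma powSection_pullbackSection {V : (projectiveSpace n k).Opens} (s : Γ(serreTwist n k m, V)) :
    powSection i p h _ (pullbackSection i _ s) = pullbackSection i _ (serrePow p s) :=
  homEquiv_symm_app_pullbackSection i (serrePowHom i p h m) s

lemma exists_isGenerator_pullbackTwist (m : ℤ) (x : X) :
    ∃ (U : X.Opens) (_ : x ∈ U) (s : Γ(pullbackTwist i m, U)),
      IsGenerator _ s ∧ IsGenerator _ (powSection i p h U s) := by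
  obtain ⟨V, hx, s, hs, hs'⟩ := exists_isGenerator_serreTwist p m (i x)
  refine ⟨i ⁻¹ᵁ V, hx, pullbackSection i _ s, hs.pullback i, ?_⟩
  rw [powSection_pullbackSection]
  exact hs'.pullback i

end Power

/-! ### The projection formula for the Frobenius -/

section Tensor

open TensorProduct

/-- Under `M ≅ M ⊗ R ≅ M ⊗ N`, where `1 : R` goes to `s`, the element `x` goes to `x ⊗ s`. -/
lemma bijective_tmul_of_bijective_smul {R M N : Type*} [CommRing R] [AddCommGroup M] [Module R M]
    [AddCommGroup N] [Module R N] {s : N} (hs : Function.Bijective fun a : R => a • s) :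
    Function.Bijective fun x : M => x ⊗ₜ[R] s := by
  let e : R ≃ₗ[R] N := LinearEquiv.ofBijective (LinearMap.toSpanSingleton R N s) hs
  convert ((TensorProduct.rid R M).symm.trans (TensorProduct.congr (.refl R M) e)).bijective using 1
  ext x
  have : e 1 = s := one_smul R s
  simp [this]

lemma addMonoidHom_tensorProduct_ext {R M N P : Type*} [CommRing R] [AddCommGroup M] [Module R M]
    [AddCommGroup N] [Module R N] [AddCommGroup P] {f g : M ⊗[R] N →+ P}
    (hfg : ∀ x y, f (x ⊗ₜ y) = g (x ⊗ₜ y)) : f = g := by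
  ext z
  induction z using TensorProduct.induction_on with
  | zero => rw [map_zero, map_zero]
  | tmul x y => exact hfg x y
  | add x y hx hy => rw [map_add, map_add, hx, hy]

variable {X : Scheme.{u}} {n : ℕ} {k : Type u} [Field k] (i : X ⟶ projectiveSpace n k)
  (p : ℕ) [hp : Fact p.Prime] (h : (p : Γ(X, ⊤)) = 0) [CharP k p] (m : ℤ) (E : X.Modules)

/-- The map `e ⊗ s ↦ e ⊗ s ^ p` on sections. -/
def tensorPow (U : X.Opens) :
    Γ(frobeniusPushforward p h E, U) ⊗[Γ(X, U)] Γ(pullbackTwist i m, U) →+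
      Γ(E, U) ⊗[Γ(X, U)] Γ(pullbackTwist i (p * m), U) :=
  TensorProduct.liftAddHom
    (AddMonoidHom.mk' (fun e => AddMonoidHom.mk'
      (fun s => (show Γ(E, U) from e) ⊗ₜ[Γ(X, U)] powSection i p h U s)
      (fun s t => by rw [powSection_add, tmul_add]))
      (fun e e' => by ext s; exact add_tmul _ _ _))
    -- The map is balanced because `a` acts on `F_* E` as `a ^ p` and `(a • s) ^ p = a ^ p • s ^ p`.
    (fun a e s => by
      change (a ^ p • (show Γ(E, U) from e)) ⊗ₜ[Γ(X, U)] powSection i p h U s =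
        (show Γ(E, U) from e) ⊗ₜ[Γ(X, U)] powSection i p h U (a • s)
      rw [powSection_smul, smul_tmul])

/-- The maps `e ↦ e ⊗ s` and `e ↦ e ⊗ s ^ p` identify source and target with the same group `Γ(E,
V)`, and between these identifications the map is the identity. -/
lemma bijective_tensorPow {U V : X.Opens} (j : V ⟶ U) {s : Γ(pullbackTwist i m, U)}
    (hs : IsGenerator _ s) (hs' : IsGenerator _ (powSection i p h U s)) :
    Function.Bijective (tensorPow i p h m E V) := by
  have h1 := bijective_tmul_of_bijective_smul (M := Γ(frobeniusPushforward p h E, V)) (hs V j)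
  have h2 := bijective_tmul_of_bijective_smul (M := Γ(E, V)) (hs' V j)
  rw [← Function.Bijective.of_comp_iff _ h1]
  rw [← powSection_res] at h2
  exact h2

/-- The presheaf `U ↦ E(U) ⊗ G(U)` of abelian groups. -/
abbrev tensorPresheaf (E G : X.Modules) : TopCat.Presheaf Ab.{u} X :=
  (PresheafOfModules.Monoidal.tensorObj (R := X.presheaf) E.val G.val).presheaf

/-- The morphism `e ⊗ s ↦ e ⊗ s ^ p` of presheaves. -/
def tensorPowHom : tensorPresheaf (frobeniusPushforward p h E) (pullbackTwist i m) ⟶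
    tensorPresheaf E (pullbackTwist i (p * m)) where
  app U := AddCommGrpCat.ofHom (tensorPow i p h m E U.unop)
  naturality U V j := by
    refine AddCommGrpCat.hom_ext (addMonoidHom_tensorProduct_ext (R := Γ(X, U.unop)) fun e s => ?_)
    exact congrArg (fun t => (show Γ(E, V.unop) from E.presheaf.map j e) ⊗ₜ[Γ(X, V.unop)] t)
      (powSection_res i p h j.unop s)

lemma isIso_presheafToSheaf_tensorPowHom :
    IsIso ((presheafToSheaf (Opens.grothendieckTopology X) Ab.{u}).map
      (tensorPowHom i p h m E)) := by
  rw [← GrothendieckTopology.W_iff, GrothendieckTopology.W_iff_isLocallyBijective]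
  refine isLocallyBijective_of_basis _ fun V x hx => ?_
  obtain ⟨U, hxU, s, hs, ht⟩ := exists_isGenerator_pullbackTwist i p h m x
  exact ⟨V ⊓ U, inf_le_left, ⟨hx, hxU⟩, bijective_tensorPow i p h m E (homOfLE inf_le_right) hs ht⟩

/-- The sheaves `(F_* E)(m)` and `E(p m)` of abelian groups are isomorphic. -/
def twistByFrobeniusPushforwardIso :
    (SheafOfModules.toSheaf X.ringCatSheaf).obj (twistBy i (frobeniusPushforward p h E) m) ≅
      (SheafOfModules.toSheaf X.ringCatSheaf).obj (twistBy i E (p * m)) :=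
  -- The underlying sheaf of `tensor` is by definition the sheafification of `tensorPresheaf` as a
  -- presheaf of abelian groups.
  @asIso _ _ _ _ ((presheafToSheaf (Opens.grothendieckTopology X) Ab.{u}).map
    (tensorPowHom i p h m E)) (isIso_presheafToSheaf_tensorPowHom i p h m E)

lemma subsingleton_H_of_iso {C : Type*} [Category C] {J : GrothendieckTopology C}
    [HasSheafify J AddCommGrpCat.{u}] [HasExt.{u} (Sheaf J AddCommGrpCat.{u})]
    {F G : Sheaf J AddCommGrpCat.{u}} (e : F ≅ G) (j : ℕ) [Subsingleton (Sheaf.H G j)] :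
    Subsingleton (Sheaf.H F j) := by
  refine Function.Injective.subsingleton (f := Sheaf.H.map e.hom j)
    (Function.LeftInverse.injective (g := Sheaf.H.map e.inv j) fun x => ?_)
  rw [← Sheaf.H.map_comp_apply, e.hom_inv_id, Sheaf.H.map_id_apply]

end Tensor

end PushACM

end

theorem mainTheorem9 {k : Type u} [Field k] [IsAlgClosed k] (p : ℕ) [Fact p.Prime] [CharP k p]
    (n : ℕ) (X : Scheme.{u}) [IsIntegral X] (i : X ⟶ PushACM.projectiveSpace n k)
    [IsClosedImmersion i] [Smooth (i ≫ PushACM.projectiveSpaceToSpec n k)]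
    (E : X.Modules) (hE : PushACM.IsACM i E) :
    PushACM.IsACM i
      ((Scheme.Modules.pushforward
        (PushACM.absFrobenius X p
          (PushACM.natCast_eq_zero_of_charP p (i ≫ PushACM.projectiveSpaceToSpec n k)))).obj E) := by
  refine ⟨PushACM.isVectorBundle_frobeniusPushforward p _
    (i ≫ PushACM.projectiveSpaceToSpec n k) hE.1, fun m j hj hj' => ?_⟩
  -- The range of `j` depends only on `X`, so the hypothesis on `E` applies in the same degree at
  -- the twist `p * m`.
  have := hE.2 (p * m) j hj hj'
  exact PushACM.subsingleton_H_of_iso (PushACM.twistByFrobeniusPushforwardIso i p _ m E) j
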